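/- Identify $\mathbf R^2$ with $\mathbf C$ by $x=x_1+ix_2$. For $u:\mathbf C\to\mathbf C$ write $u'=(\partial_{x_1}u,\partial_{x_2}u)\in\mathbf C^2$, $\frac{\partial u}{\partial\bar x}=\frac12(\partial_{x_1}u+i\,\partial_{x_2}u)$, and let $dx=(1,i)\in\mathbf C^2$. Fix $m>0$ not an integer, $M\ge1$, and real numbers $N_0,N_1,N_2,\dots$. Consider - a lattice $L=\mathbf Ze_1\oplus\mathbf Ze_2\subset\mathbf C$ with $|e_1|,|e_2|\le M$ and $|\operatorname{Im}(\bar e_1e_2)|\ge 1/M$; - a function $F(x,\xi)$, holomorphic for $x,\xi\in\mathbf C^2$, $|\operatorname{Im}x_1|,|\operatorname{Im}x_2|,|\xi|<1/M$, $L$-periodic in $x$, with $|F(x,\xi)|\le M|\xi|^2$; put $G(x,\xi;\tilde\epsilon)=\tilde\epsilon^{-2}F(x,\tilde\epsilon\xi)$ and $G_a(x,\xi;\tilde\epsilon)=G(x,\xi+a\,dx;\tilde\epsilon)$ for $a\in\mathbf C$; - smooth $L$-periodic functions $\gamma:\mathbf R^2\to\mathbf C^2$ and $r:\mathbf R^2\to\mathbf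 C$ that are $O(\epsilon)$ in the $C^\infty$ sense: their derivatives of each order $j$ are bounded by $N_j\epsilon$. The data $L,F,\gamma,r$ may depend on $\epsilon,\tilde\epsilon$. Consider the equation $$\frac{\partial u}{\partial\bar x}+\tilde\epsilon\,G_a\Big(x,u'-\frac{\gamma}{\tilde\epsilon};\tilde\epsilon\Big)-\frac{r(x)}{\tilde\epsilon}=0\qquad\text{on }\mathbf R^2 \tag{1.18}$$ for grad-periodic functions with antiholomorphic linear part, that is, for $u=u_{\rm per}+b\bar x$ with $b\in\mathbf C$, $u_{\rm per}$ $L$-periodic and $u_{\rm per}'\in C^m$ (the Hölder space). **Proposition 1.2.** There are constants $C_0\ge1$ and $K>0$, depending only on $m$, $M$ and $(N_j)$, such that for every $C\ge C_0$ there is $\kappa>0$, depending only on $m$, $M$, $(N_j)$ and $C$, with the following property. For all data as above, all $0<\epsilon\le\kappa\tilde\epsilon$ with $\tilde\epsilon\le\kappa$, and all $a\in\mathbf C$ with $|a|<1$, equation (1.18) has a solution $u=u_{\rm per}+b\bar x$ with $$|b|+\|u_{\rm per}'\|_{C^m}\le\frac1C .$$ This solution is unique modulo constants among the solutions of this form satisfying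 this bound, and $$|b|+\|u_{\rm per}'\|_{C^m}\le K\Big(\tilde\epsilon+\frac{\epsilon}{\tilde\epsilon}\Big).$$ -/

import Mathlib

open scoped ENNReal ContDiff

noncomputable section

namespace CauchyRiemannTorus

/-- `u' = (∂u/∂x₁, ∂u/∂x₂)`, the complex covector field given by the differential of a
function `u` of `x = x₁ + i x₂`, where `ℂ` is regarded as `ℝ²`. -/
def grad (u : ℂ → ℂ) (x : ℂ) : ℂ × ℂ :=
  (fderiv ℝ u x 1, fderiv ℝ u x Complex.I)

/-- `∂u/∂x̄ = (∂u/∂x₁ + i ∂u/∂x₂) / 2`. -/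
def dbar (u : ℂ → ℂ) (x : ℂ) : ℂ :=
  (1 / 2) * ((grad u x).1 + Complex.I * (grad u x).2)

/-- The inclusion of `ℝ² ≅ ℂ` in its complexification `ℂ²`. -/
def toC2 (x : ℂ) : ℂ × ℂ := ((x.re : ℂ), (x.im : ℂ))

/-- The covector `dx = dx₁ + i dx₂`, in the basis `dx₁, dx₂`. -/
def dx : ℂ × ℂ := (1, Complex.I)

/-- The complex tubular neighborhood `|Im x₁|, |Im x₂| < ρ`, `|ξ| < ρ` of `ℝ² × {0}` in
`ℂ² × ℂ²`. -/
def tube (ρ : ℝ) : Set ((ℂ × ℂ) × (ℂ × ℂ)) :=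
  {z | |z.1.1.im| < ρ ∧ |z.1.2.im| < ρ ∧ ‖z.2‖ < ρ}

/-- The vectors `e₁, e₂` generate a lattice `L = ℤe₁ ⊕ ℤe₂` in `ℂ`, with `|e₁|, |e₂| ≤ M` and
a period parallelogram of area at least `1 / M`. -/
structure IsLatticeBasis (M : ℝ) (e₁ e₂ : ℂ) : Prop where
  norm_fst : ‖e₁‖ ≤ M
  norm_snd : ‖e₂‖ ≤ M
  area : 1 / M ≤ |((starRingEnd ℂ) e₁ * e₂).im|

/-- `f` is periodic with respect to the lattice `ℤe₁ ⊕ ℤe₂`. -/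
def LatticePeriodic {E : Type*} (e₁ e₂ : ℂ) (f : ℂ → E) : Prop :=
  Function.Periodic f e₁ ∧ Function.Periodic f e₂

/-- `F(x, ξ)` is holomorphic in the tube of radius `1 / M`, lattice periodic in `x`, and
`|F(x, ξ)| ≤ M |ξ|²` there. -/
structure IsNonlinearity (M : ℝ) (e₁ e₂ : ℂ) (F : (ℂ × ℂ) × (ℂ × ℂ) → ℂ) : Prop where
  holomorphic : AnalyticOnNhd ℂ F (tube (1 / M))
  periodic_fst : ∀ x ξ, (x, ξ) ∈ tube (1 / M) → F (x + toC2 e₁, ξ) = F (x, ξ)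
  periodic_snd : ∀ x ξ, (x, ξ) ∈ tube (1 / M) → F (x + toC2 e₂, ξ) = F (x, ξ)
  bound : ∀ x ξ, (x, ξ) ∈ tube (1 / M) → ‖F (x, ξ)‖ ≤ M * ‖ξ‖ ^ 2

/-- `f` is smooth and lattice periodic on `ℂ ≅ ℝ²`, and `f = O(ε)` in the `C^∞` sense: the
derivatives of order `j` are bounded by `N j * ε`. -/
structure IsSmoothBigO {E : Type*} [NormedAddCommGroup E] [NormedSpace ℝ E]
    (N : ℕ → ℝ) (ε : ℝ) (e₁ e₂ : ℂ) (f : ℂ → E) : Prop where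
  smooth : ContDiff ℝ ∞ f
  periodic : LatticePeriodic e₁ e₂ f
  bound : ∀ (j : ℕ) (x : ℂ), ‖iteratedFDeriv ℝ j f x‖ ≤ N j * ε

/-- `G(x, ξ; ε') = F(x, ε' ξ) / ε'²` for real `x`. -/
def G (F : (ℂ × ℂ) × (ℂ × ℂ) → ℂ) (ε' : ℝ) (x : ℂ) (ξ : ℂ × ℂ) : ℂ :=
  F (toC2 x, (ε' : ℂ) • ξ) / (ε' : ℂ) ^ 2

/-- `G_a(x, ξ; ε') = G(x, ξ + a dx; ε')`. -/
def Ga (F : (ℂ × ℂ) × (ℂ × ℂ) → ℂ) (a : ℂ) (ε' : ℝ) (x : ℂ) (ξ : ℂ × ℂ) : ℂ :=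
  G F ε' x (ξ + a • dx)

/-- The equation `∂u/∂x̄ + ε' G_a(x, u' - γ/ε'; ε') - r/ε' = 0`. -/
def SolvesEquation (F : (ℂ × ℂ) × (ℂ × ℂ) → ℂ) (γ : ℂ → ℂ × ℂ) (r : ℂ → ℂ)
    (ε' : ℝ) (a : ℂ) (u : ℂ → ℂ) : Prop :=
  ∀ x : ℂ, dbar u x + (ε' : ℂ) * Ga F a ε' x (grad u x - (ε' : ℂ)⁻¹ • γ x) - r x / (ε' : ℂ) = 0

/-- The Hölder norm of `C^m`, `m > 0` not an integer, with values in `[0, ∞]`: the sup norms of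
the derivatives of order at most `⌊m⌋`, plus the Hölder seminorm of exponent `m - ⌊m⌋` of the
derivative of order `⌊m⌋`. It is meant for functions of class `C^⌊m⌋`. -/
def holderNorm (m : ℝ) (v : ℂ → ℂ × ℂ) : ℝ≥0∞ :=
  (∑ j ∈ Finset.range (⌊m⌋₊ + 1), ⨆ x : ℂ, ‖iteratedFDeriv ℝ j v x‖ₑ)
    + eHolderNorm (m - ⌊m⌋₊).toNNReal (iteratedFDeriv ℝ ⌊m⌋₊ v)

/-- `|b| + ‖u_per'‖_{C^m}`. -/
def size (m : ℝ) (uper : ℂ → ℂ) (b : ℂ) : ℝ≥0∞ :=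
  ‖b‖ₑ + holderNorm m (grad uper)

/-- The grad-periodic function `u = u_per + b x̄`, with antiholomorphic linear part. -/
def gradPeriodic (uper : ℂ → ℂ) (b : ℂ) (x : ℂ) : ℂ :=
  uper x + b * (starRingEnd ℂ) x

/-- `u = u_per + b x̄`, with `u_per` lattice periodic and `u_per'` in `C^m`, solves the equation
and satisfies `|b| + ‖u_per'‖_{C^m} ≤ R`. -/
structure IsSolutionInBall (m : ℝ) (e₁ e₂ : ℂ) (F : (ℂ × ℂ) × (ℂ × ℂ) → ℂ)
    (γ : ℂ → ℂ × ℂ) (r : ℂ → ℂ) (ε' : ℝ) (a : ℂ) (R : ℝ) (uper : ℂ → ℂ) (b : ℂ) : Prop where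
  contDiff : ContDiff ℝ ((⌊m⌋₊ + 1 : ℕ) : ℕ∞) uper
  periodic : LatticePeriodic e₁ e₂ uper
  solves : SolvesEquation F γ r ε' a (gradPeriodic uper b)
  size_le : size m uper b ≤ ENNReal.ofReal R

end CauchyRiemannTorus

end

noncomputable section

namespace CauchyRiemannTorus

/-! ### Bounded families and the sequence space `ℓ¹` -/

section SequenceSpace

variable {ι : Type*} {E : Type*} [NormedAddCommGroup E] [NormedSpace ℂ E] [CompleteSpace E]

/-! The unknown is `f = ∂u/∂x̄`. On the torus `∂/∂x̄` multiplies the character of frequency `n` by a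
symbol that vanishes only at `n = 0`, and the symbol of `∂/∂x` has the same modulus. Hence `u =
u_per + b x̄` is determined by `f` up to constants: `b` is the mean of `f`, and `u' = (f + Sf, i(Sf
- f))`, where the Beurling transform `S` (`beurling`) is a Fourier multiplier bounded by 1. The
equation becomes `f = (r - F(x, ε'u' - γ + ε'a dx)) / ε'`. Since `F` is quadratic in `ξ` and its
argument is `O(ε')`, the `F` term is `O(ε')` and has Lipschitz constant `O(ε')` in `f`, while `r/ε'`
is `O(ε/ε')`. The right side is therefore a contraction of the unit ball whose fixed point has size
`O(ε' + ε/ε')` (`exists_solution`).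

The contraction runs not in `C^m` but in a weighted Wiener algebra of absolutely convergent Fourier
series. There a multiplier bounded by 1 has norm at most 1, and the norm is submultiplicative, so
`F` can be substituted as a power series in `ξ` whose coefficients lie in the algebra. With weight
exponent `⌊m⌋ + 1` the norm controls the `C^m` norm of the gradient (`size_primitive_le`). The data
enter the algebra at the cost of three derivatives (`exists_wiener`); for `F` these derivatives come
from Cauchy estimates in `x`.

Uniqueness is claimed among all `C^m` solutions in the ball, whose derivatives need not lie in this
algebra, so it rests on a separate `L²` argument. For the difference `w` of two solutions the
equation gives `|∂w/∂x̄| ≤ |∂w/∂x| / 2` pointwise, whereas Parseval and the equal moduli of the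
symbols give `‖∂w/∂x‖ ≤ ‖∂w/∂x̄‖` in `L²`; so both vanish (`grad_eq_zero_of_norm_dbar_le`). This
uses only sup bounds for the gradients. -/

theorem l1_hasSum_norm (x : lp (fun _ : ι => ℂ) 1) : HasSum (fun i => ‖x i‖) ‖x‖ := by
  simpa using lp.hasSum_norm (p := 1) (by simp) x

theorem l1_summable_smul (x : lp (fun _ : ι => ℂ) 1) {v : ι → E} {C : ℝ}
    (hv : ∀ i, ‖v i‖ ≤ C) : Summable fun i => x i • v i :=
  .of_norm_bounded ((l1_hasSum_norm x).summable.mul_right C) fun i => by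
    rw [norm_smul]; gcongr; exact hv i

/-- The continuous linear map on `ℓ¹` that extends a bounded family of vectors. -/
def l1Lift (v : ι → E) (C : ℝ) (hv : ∀ i, ‖v i‖ ≤ C) : lp (fun _ : ι => ℂ) 1 →L[ℂ] E :=
  LinearMap.mkContinuous
    { toFun := fun x => ∑' i, x i • v i
      map_add' := fun x y => by
        simp only [lp.coeFn_add, Pi.add_apply, add_smul]
        exact (l1_summable_smul x hv).tsum_add (l1_summable_smul y hv)
      map_smul' := fun c x => by
        simp only [lp.coeFn_smul, Pi.smul_apply, smul_assoc, RingHom.id_apply]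
        exact (l1_summable_smul x hv).tsum_const_smul c }
    C fun x => by
      rw [mul_comm]
      refine tsum_of_norm_bounded ((l1_hasSum_norm x).mul_right C) fun i => ?_
      rw [norm_smul]; gcongr; exact hv i

theorem l1Lift_apply (v : ι → E) (C : ℝ) (hv : ∀ i, ‖v i‖ ≤ C) (x : lp (fun _ : ι => ℂ) 1) :
    l1Lift v C hv x = ∑' i, x i • v i := rfl

theorem norm_l1Lift_apply_le (v : ι → E) (C : ℝ) (hv : ∀ i, ‖v i‖ ≤ C)
    (x : lp (fun _ : ι => ℂ) 1) : ‖l1Lift v C hv x‖ ≤ C * ‖x‖ := by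
  rw [mul_comm]
  refine tsum_of_norm_bounded ((l1_hasSum_norm x).mul_right C) fun i => ?_
  rw [norm_smul]; gcongr; exact hv i

theorem hasSum_l1Lift (v : ι → E) (C : ℝ) (hv : ∀ i, ‖v i‖ ≤ C) (x : lp (fun _ : ι => ℂ) 1) :
    HasSum (fun i => x i • v i) (l1Lift v C hv x) :=
  (l1_summable_smul x hv).hasSum

variable [DecidableEq ι]

theorem l1Lift_single (v : ι → E) (C : ℝ) (hv : ∀ i, ‖v i‖ ≤ C) (i : ι) :
    l1Lift v C hv (lp.single 1 i 1) = v i := by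
  rw [l1Lift_apply, tsum_eq_single i]
  · simp
  · intro j hj
    simp [Pi.single_eq_of_ne hj]

/-- Finite sequences are dense in `ℓ¹`. Applied repeatedly, this reduces every multilinear identity
in the Wiener algebra to an identity between characters. -/
theorem l1_ext {F : Type*} [NormedAddCommGroup F] [NormedSpace ℂ F]
    {f g : lp (fun _ : ι => ℂ) 1 →L[ℂ] F}
    (h : ∀ i, f (lp.single 1 i 1) = g (lp.single 1 i 1)) : f = g := by
  ext x
  have hx := lp.hasSum_single (E := fun _ : ι => ℂ) (p := 1) (by simp) x
  have key : ∀ i, f (lp.single 1 i (x i)) = g (lp.single 1 i (x i)) := fun i => by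
    have : lp.single (E := fun _ : ι => ℂ) 1 i (x i) = x i • lp.single 1 i 1 := by
      rw [← lp.single_smul]; simp
    rw [this, map_smul, map_smul, h]
  have hf := f.hasSum hx
  have hg := g.hasSum hx
  simp only [key] at hf
  exact hf.unique hg

end SequenceSpace

/-! ### The weighted Wiener algebra of the torus -/

/-- The weight `(1 + |n|)^k` on the dual lattice. -/
def wt (k : ℕ) (n : Fin 2 → ℤ) : ℝ := (1 + ‖n‖) ^ k

theorem one_le_wt (k : ℕ) (n : Fin 2 → ℤ) : 1 ≤ wt k n :=
  one_le_pow₀ (by linarith [norm_nonneg n])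

theorem wt_pos (k : ℕ) (n : Fin 2 → ℤ) : 0 < wt k n := one_pos.trans_le (one_le_wt k n)

theorem wt_ne_zero (k : ℕ) (n : Fin 2 → ℤ) : (wt k n : ℂ) ≠ 0 :=
  Complex.ofReal_ne_zero.2 (wt_pos k n).ne'

theorem wt_zero (k : ℕ) : wt k 0 = 1 := by simp [wt]

/-- Submultiplicativity of the weight is what makes the weighted `ℓ¹` space a Banach algebra under
convolution. -/
theorem wt_add_le (k : ℕ) (m n : Fin 2 → ℤ) : wt k (m + n) ≤ wt k m * wt k n := by
  rw [wt, wt, wt, ← mul_pow]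
  refine pow_le_pow_left₀ (by positivity) ?_ k
  nlinarith [norm_add_le m n, norm_nonneg m, norm_nonneg n, mul_nonneg (norm_nonneg m)
    (norm_nonneg n)]

/-- The Wiener algebra of Fourier series `∑ cₙ eₙ` with `∑ (1 + |n|)^k |cₙ| < ∞`, realized as
the sequences `(1 + |n|)^k cₙ` in `ℓ¹`. -/
def Wiener (_k : ℕ) : Type := lp (fun _ : Fin 2 → ℤ => ℂ) 1

namespace Wiener

variable {k : ℕ}

instance : NormedAddCommGroup (Wiener k) :=
  inferInstanceAs (NormedAddCommGroup (lp (fun _ : Fin 2 → ℤ => ℂ) 1))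

instance : NormedSpace ℂ (Wiener k) :=
  inferInstanceAs (NormedSpace ℂ (lp (fun _ : Fin 2 → ℤ => ℂ) 1))

instance : CompleteSpace (Wiener k) :=
  inferInstanceAs (CompleteSpace (lp (fun _ : Fin 2 → ℤ => ℂ) 1))

/-- The `n`-th Fourier coefficient. -/
def coeff (f : Wiener k) (n : Fin 2 → ℤ) : ℂ :=
  (show lp (fun _ : Fin 2 → ℤ => ℂ) 1 from f) n / wt k n

/-- The character `eₙ`, divided by its norm. -/
def unit (k : ℕ) (n : Fin 2 → ℤ) : Wiener k :=
  (lp.single 1 n 1 : lp (fun _ : Fin 2 → ℤ => ℂ) 1)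

theorem norm_unit (n : Fin 2 → ℤ) : ‖unit k n‖ = 1 := by
  have := lp.norm_single (E := fun _ : Fin 2 → ℤ => ℂ) (p := 1) (by simp) n (1 : ℂ)
  rw [norm_one] at this
  exact this

theorem hasSum_norm_coeff (f : Wiener k) :
    HasSum (fun n => wt k n * ‖coeff f n‖) ‖f‖ := by
  refine (l1_hasSum_norm (show lp (fun _ : Fin 2 → ℤ => ℂ) 1 from f)).congr_fun fun n => ?_
  rw [coeff, norm_div, Complex.norm_real, Real.norm_of_nonneg (wt_pos k n).le]
  exact mul_div_cancel₀ _ (wt_pos k n).ne'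

theorem ext_coeff {f g : Wiener k} (h : ∀ n, coeff f n = coeff g n) : f = g := by
  refine lp.ext (funext fun n => ?_)
  have := h n
  rw [coeff, coeff, div_left_inj' (wt_ne_zero k n)] at this
  exact this

theorem coeff_add (f g : Wiener k) (n : Fin 2 → ℤ) :
    coeff (f + g) n = coeff f n + coeff g n := by
  rw [coeff, coeff, coeff, ← add_div]; rfl

theorem coeff_sub (f g : Wiener k) (n : Fin 2 → ℤ) :
    coeff (f - g) n = coeff f n - coeff g n := by
  rw [coeff, coeff, coeff, ← sub_div]; rfl

theorem coeff_smul (c : ℂ) (f : Wiener k) (n : Fin 2 → ℤ) :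
    coeff (c • f) n = c * coeff f n := by
  rw [coeff, coeff, ← mul_div_assoc]; rfl

/-- The element with given Fourier coefficients. -/
def ofCoeff (c : (Fin 2 → ℤ) → ℂ) (hc : Summable fun n => wt k n * ‖c n‖) : Wiener k :=
  (⟨fun n => wt k n * c n, memℓp_gen (by
    simpa [abs_of_pos (wt_pos k _)] using hc)⟩ : lp (fun _ : Fin 2 → ℤ => ℂ) 1)

theorem coeff_ofCoeff (c : (Fin 2 → ℤ) → ℂ) (hc : Summable fun n => wt k n * ‖c n‖)
    (n : Fin 2 → ℤ) : coeff (ofCoeff c hc) n = c n := by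
  rw [coeff]
  exact mul_div_cancel_left₀ _ (wt_ne_zero k n)

theorem norm_ofCoeff (c : (Fin 2 → ℤ) → ℂ) (hc : Summable fun n => wt k n * ‖c n‖) :
    ‖ofCoeff c hc‖ = ∑' n, wt k n * ‖c n‖ := by
  rw [← (hasSum_norm_coeff (ofCoeff c hc)).tsum_eq]
  simp only [coeff_ofCoeff]

variable {E : Type*} [NormedAddCommGroup E] [NormedSpace ℂ E]

theorem clm_ext {f g : Wiener k →L[ℂ] E} (h : ∀ n, f (unit k n) = g (unit k n)) : f = g :=
  l1_ext (f := f) (g := g) h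

variable [CompleteSpace E]

/-- The continuous linear map that sends `eₙ` to `v n`, where `|v n| ≤ C (1 + |n|)^k`. -/
def lift (v : (Fin 2 → ℤ) → E) (C : ℝ) (hv : ∀ n, ‖v n‖ ≤ C * wt k n) : Wiener k →L[ℂ] E :=
  l1Lift (fun n => (wt k n : ℂ)⁻¹ • v n) C fun n => by
    rw [norm_smul, norm_inv, Complex.norm_real, Real.norm_of_nonneg (wt_pos k n).le,
      inv_mul_le_iff₀ (wt_pos k n), mul_comm]
    exact hv n

theorem hasSum_lift (v : (Fin 2 → ℤ) → E) (C : ℝ) (hv : ∀ n, ‖v n‖ ≤ C * wt k n)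
    (f : Wiener k) : HasSum (fun n => coeff f n • v n) (lift v C hv f) := by
  refine (hasSum_l1Lift _ _ _ _).congr_fun fun n => ?_
  rw [coeff, div_eq_mul_inv, mul_smul]

theorem norm_lift_apply_le (v : (Fin 2 → ℤ) → E) (C : ℝ) (hv : ∀ n, ‖v n‖ ≤ C * wt k n)
    (f : Wiener k) : ‖lift v C hv f‖ ≤ C * ‖f‖ :=
  norm_l1Lift_apply_le _ _ _ _

theorem lift_unit (v : (Fin 2 → ℤ) → E) (C : ℝ) (hv : ∀ n, ‖v n‖ ≤ C * wt k n)
    (n : Fin 2 → ℤ) : lift v C hv (unit k n) = (wt k n : ℂ)⁻¹ • v n :=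
  l1Lift_single _ _ _ _

/-! The convolution product. -/

/-- The structure constants of the basis of normalized characters. -/
def mulCoeff (k : ℕ) (m n : Fin 2 → ℤ) : ℂ := wt k (m + n) / (wt k m * wt k n)

theorem norm_mulCoeff_le (m n : Fin 2 → ℤ) : ‖mulCoeff k m n‖ ≤ 1 := by
  rw [mulCoeff, ← Complex.ofReal_mul, ← Complex.ofReal_div, Complex.norm_real,
    Real.norm_of_nonneg (div_nonneg (wt_pos _ _).le (mul_pos (wt_pos _ _) (wt_pos _ _)).le)]
  exact div_le_one_of_le₀ (wt_add_le k m n) (mul_pos (wt_pos _ _) (wt_pos _ _)).le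

/-- Multiplication by a normalized character. -/
def mulUnit (m : Fin 2 → ℤ) : Wiener k →L[ℂ] Wiener k :=
  l1Lift (fun n => mulCoeff k m n • unit k (m + n)) 1 fun n => by
    rw [norm_smul, norm_unit, mul_one]; exact norm_mulCoeff_le m n

/-- The convolution product as a continuous bilinear map. -/
def mulL : Wiener k →L[ℂ] Wiener k →L[ℂ] Wiener k :=
  l1Lift (fun m => mulUnit m) 1 fun _ =>
    ContinuousLinearMap.opNorm_le_bound _ zero_le_one fun f => norm_l1Lift_apply_le _ _ _ f

theorem mulL_unit (m n : Fin 2 → ℤ) :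
    mulL (unit k m) (unit k n) = mulCoeff k m n • unit k (m + n) := by
  have h1 : mulL (unit k m) = mulUnit m := l1Lift_single _ _ _ _
  rw [h1]
  exact l1Lift_single _ _ _ _

theorem norm_mulL_le (f g : Wiener k) : ‖mulL f g‖ ≤ ‖f‖ * ‖g‖ := by
  refine (ContinuousLinearMap.le_opNorm _ _).trans ?_
  gcongr
  have : ‖mulL f‖ ≤ 1 * ‖f‖ := norm_l1Lift_apply_le _ _ _ f
  rwa [one_mul] at this

theorem mulL_comm (f g : Wiener k) : mulL f g = mulL g f := by
  have : mulL (k := k) = mulL.flip := by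
    refine clm_ext fun m => clm_ext fun n => ?_
    rw [ContinuousLinearMap.flip_apply, mulL_unit, mulL_unit, mulCoeff, mulCoeff, add_comm m n,
      mul_comm (wt k m : ℂ)]
  exact congrArg (fun T => T f g) this

theorem mulL_assoc (f g h : Wiener k) : mulL (mulL f g) h = mulL f (mulL g h) := by
  -- Both bracketings are written as continuous trilinear maps, so that `clm_ext` can be applied
  -- once in each variable.
  let A : Wiener k →L[ℂ] Wiener k →L[ℂ] Wiener k →L[ℂ] Wiener k :=
    (ContinuousLinearMap.compL ℂ (Wiener k) (Wiener k) (Wiener k →L[ℂ] Wiener k) mulL).comp mulL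
  let B : Wiener k →L[ℂ] Wiener k →L[ℂ] Wiener k →L[ℂ] Wiener k :=
    (((ContinuousLinearMap.compL ℂ (Wiener k) (Wiener k →L[ℂ] Wiener k)
      (Wiener k →L[ℂ] Wiener k)).flip mulL).comp
      ((ContinuousLinearMap.compL ℂ (Wiener k) (Wiener k) (Wiener k)).comp mulL))
  have hA : ∀ f g h, A f g h = mulL (mulL f g) h := fun _ _ _ => rfl
  have hB : ∀ f g h, B f g h = mulL f (mulL g h) := fun _ _ _ => rfl
  have : A = B := by
    refine clm_ext fun l => clm_ext fun m => clm_ext fun n => ?_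
    simp only [hA, hB, mulL_unit, map_smul, smul_apply, smul_smul, add_assoc]
    congr 1
    simp only [mulCoeff, add_assoc]
    have := wt_ne_zero k l
    have := wt_ne_zero k m
    have := wt_ne_zero k n
    have := wt_ne_zero k (l + m)
    have := wt_ne_zero k (m + n)
    field_simp
  rw [← hA, ← hB, this]

theorem mulL_unit_zero (f : Wiener k) : mulL (unit k 0) f = f := by
  have : mulL (unit k 0) = ContinuousLinearMap.id ℂ (Wiener k) := by
    refine clm_ext fun n => ?_
    rw [mulL_unit, mulCoeff, wt_zero, zero_add]
    simp [div_self (wt_ne_zero k n)]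
  rw [this]; rfl

instance : NormedCommRing (Wiener k) where
  __ := (inferInstance : NormedAddCommGroup (Wiener k))
  mul f g := mulL f g
  one := unit k 0
  left_distrib f g h := map_add (mulL f) g h
  right_distrib f g h := by
    change mulL (f + g) h = mulL f h + mulL g h
    rw [map_add, add_apply]
  zero_mul f := by
    change mulL 0 f = 0
    rw [map_zero, zero_apply]
  mul_zero f := map_zero (mulL f)
  mul_assoc := mulL_assoc
  one_mul := mulL_unit_zero
  mul_one f := (mulL_comm _ _).trans (mulL_unit_zero f)
  mul_comm := mulL_comm
  norm_mul_le := norm_mulL_le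

theorem mul_def (f g : Wiener k) : f * g = mulL f g := rfl

instance : NormOneClass (Wiener k) := ⟨norm_unit 0⟩

instance : NormedAlgebra ℂ (Wiener k) where
  toAlgebra := Algebra.ofModule
    (fun c f g => by
      rw [mul_def, map_smul, smul_apply, mul_def])
    (fun c f g => by rw [mul_def, map_smul, mul_def])
  norm_smul_le := norm_smul_le

/-! ### Characters and Fourier multipliers on the Wiener algebra. -/

/-- The algebra homomorphism that extends a unitary character of `ℤ²`. -/
def charHom (χ : (Fin 2 → ℤ) → ℂ) (h0 : χ 0 = 1) (hadd : ∀ m n, χ (m + n) = χ m * χ n)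
    (hχ : ∀ n, ‖χ n‖ ≤ 1) : Wiener k →ₐ[ℂ] ℂ :=
  have hv : ∀ n, ‖χ n‖ ≤ 1 * wt k n := fun n => by linarith [hχ n, one_le_wt k n]
  AlgHom.ofLinearMap (lift χ 1 hv).toLinearMap
    (by
      change lift χ 1 hv (unit k 0) = 1
      rw [lift_unit, wt_zero, h0]; simp)
    (fun f g => by
      have : ((ContinuousLinearMap.compL ℂ (Wiener k) (Wiener k) ℂ) (lift χ 1 hv)).comp mulL =
          ((ContinuousLinearMap.mul ℂ ℂ).bilinearComp (lift χ 1 hv) (lift χ 1 hv)) := by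
        refine clm_ext fun m => clm_ext fun n => ?_
        change lift χ 1 hv (mulL (unit k m) (unit k n)) =
          lift χ 1 hv (unit k m) * lift χ 1 hv (unit k n)
        rw [mulL_unit, map_smul, lift_unit, lift_unit, lift_unit, hadd, mulCoeff]
        simp only [smul_eq_mul]
        have := wt_ne_zero k m
        have := wt_ne_zero k n
        have := wt_ne_zero k (m + n)
        field_simp
      exact congrArg (fun T => T f g) this)

theorem hasSum_charHom (χ : (Fin 2 → ℤ) → ℂ) (h0 : χ 0 = 1)
    (hadd : ∀ m n, χ (m + n) = χ m * χ n) (hχ : ∀ n, ‖χ n‖ ≤ 1) (f : Wiener k) :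
    HasSum (fun n => coeff f n * χ n) (charHom χ h0 hadd hχ f) :=
  hasSum_lift χ 1 (fun n => by linarith [hχ n, one_le_wt k n]) f

theorem norm_charHom_le (χ : (Fin 2 → ℤ) → ℂ) (h0 : χ 0 = 1)
    (hadd : ∀ m n, χ (m + n) = χ m * χ n) (hχ : ∀ n, ‖χ n‖ ≤ 1) (f : Wiener k) :
    ‖charHom χ h0 hadd hχ f‖ ≤ ‖f‖ := by
  have := norm_lift_apply_le χ 1 (fun n => by linarith [hχ n, one_le_wt k n]) f
  rwa [one_mul] at this

/-- The Fourier multiplier with a symbol bounded by `1`. -/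
def multiplier (μ : (Fin 2 → ℤ) → ℂ) (hμ : ∀ n, ‖μ n‖ ≤ 1) (f : Wiener k) : Wiener k :=
  ofCoeff (fun n => μ n * coeff f n) (by
    refine Summable.of_nonneg_of_le (fun n => mul_nonneg (wt_pos k n).le (norm_nonneg _))
      (fun n => ?_) (hasSum_norm_coeff f).summable
    rw [norm_mul]
    exact mul_le_mul_of_nonneg_left (mul_le_of_le_one_left (norm_nonneg _) (hμ n))
      (wt_pos k n).le)

theorem coeff_multiplier (μ : (Fin 2 → ℤ) → ℂ) (hμ : ∀ n, ‖μ n‖ ≤ 1) (f : Wiener k)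
    (n : Fin 2 → ℤ) : coeff (multiplier μ hμ f) n = μ n * coeff f n :=
  coeff_ofCoeff _ _ n

theorem norm_multiplier_le (μ : (Fin 2 → ℤ) → ℂ) (hμ : ∀ n, ‖μ n‖ ≤ 1) (f : Wiener k) :
    ‖multiplier μ hμ f‖ ≤ ‖f‖ := by
  refine hasSum_le (fun n => ?_) (hasSum_norm_coeff (multiplier μ hμ f)) (hasSum_norm_coeff f)
  rw [coeff_multiplier, norm_mul]
  exact mul_le_mul_of_nonneg_left (mul_le_of_le_one_left (norm_nonneg _) (hμ n)) (wt_pos k n).le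

theorem multiplier_sub (μ : (Fin 2 → ℤ) → ℂ) (hμ : ∀ n, ‖μ n‖ ≤ 1) (f g : Wiener k) :
    multiplier μ hμ (f - g) = multiplier μ hμ f - multiplier μ hμ g :=
  ext_coeff fun n => by simp only [coeff_multiplier, coeff_sub, mul_sub]

end Wiener

/-! ### Substitution into power series in two variables -/

section PowerSeries

variable {A : Type*} [NormedCommRing A]

/-- Cauchy bounds for the coefficients of a power series in two variables that is `O(|ξ|²)`. -/
structure QuadraticCoeffs (c : ℕ × ℕ → A) (B r₀ : ℝ) : Prop where
  bound : ∀ i r, 0 < r → r ≤ r₀ → ‖c i‖ * r ^ (i.1 + i.2) ≤ B * r ^ 2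

/-- The sum `∑ cᵢⱼ Pⁱ Qʲ`. -/
def psEval (c : ℕ × ℕ → A) (P Q : A) : A := ∑' i, c i * (P ^ i.1 * Q ^ i.2)

variable {c : ℕ × ℕ → A} {B r₀ R : ℝ}

/-- Using the Cauchy bound at radius `4R` gains the geometric factor `4^{-(i+j)}` at radius `R`; the
constant 16 is `4²`. -/
theorem QuadraticCoeffs.norm_mul_pow_le (hc : QuadraticCoeffs c B r₀) (hR : 0 < R)
    (hRr : 4 * R ≤ r₀) (i : ℕ × ℕ) :
    ‖c i‖ * R ^ (i.1 + i.2) ≤ 16 * B * R ^ 2 * (1 / 4) ^ (i.1 + i.2) := by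
  have h := hc.bound i (4 * R) (by positivity) hRr
  rw [mul_pow] at h
  rw [one_div, inv_pow, ← div_eq_mul_inv, le_div_iff₀ (by positivity)]
  nlinarith

theorem QuadraticCoeffs.nonneg (hc : QuadraticCoeffs c B r₀) (hr : 0 < r₀) : 0 ≤ B := by
  have h := hc.bound 0 r₀ hr le_rfl
  have : 0 ≤ B * r₀ ^ 2 := le_trans (by positivity) h
  exact nonneg_of_mul_nonneg_left this (by positivity)

variable [NormOneClass A]

theorem norm_monomial_le {P Q : A} {R : ℝ} (hP : ‖P‖ ≤ R) (hQ : ‖Q‖ ≤ R) (a b : ℕ) :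
    ‖P ^ a * Q ^ b‖ ≤ R ^ (a + b) := by
  rw [pow_add]
  refine (norm_mul_le _ _).trans (mul_le_mul ((norm_pow_le _ _).trans ?_)
    ((norm_pow_le _ _).trans ?_) (norm_nonneg _) (pow_nonneg ((norm_nonneg P).trans hP) _))
  · gcongr
  · gcongr

/-- The extra factor `R` on the left avoids the exponent `n - 1`. -/
theorem norm_pow_sub_pow_le_of_le {P P' : A} {R : ℝ} (hP : ‖P‖ ≤ R) (hP' : ‖P'‖ ≤ R) (n : ℕ) :
    R * ‖P ^ n - P' ^ n‖ ≤ n * R ^ n * ‖P - P'‖ := by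
  have hR : 0 ≤ R := (norm_nonneg P).trans hP
  induction n with
  | zero => simp
  | succ n ih =>
    have h : P ^ (n + 1) - P' ^ (n + 1) = P * (P ^ n - P' ^ n) + (P - P') * P' ^ n := by ring
    have h1 : ‖P * (P ^ n - P' ^ n)‖ ≤ R * ‖P ^ n - P' ^ n‖ :=
      (norm_mul_le _ _).trans (by gcongr)
    have h2 : ‖(P - P') * P' ^ n‖ ≤ ‖P - P'‖ * R ^ n :=
      (norm_mul_le _ _).trans (by gcongr; exact (norm_pow_le _ _).trans (by gcongr))
    calc R * ‖P ^ (n + 1) - P' ^ (n + 1)‖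
        ≤ R * (R * ‖P ^ n - P' ^ n‖ + ‖P - P'‖ * R ^ n) := by
          rw [h]; gcongr; exact (norm_add_le _ _).trans (add_le_add h1 h2)
      _ ≤ R * (n * R ^ n * ‖P - P'‖ + ‖P - P'‖ * R ^ n) := by gcongr
      _ = _ := by push_cast; ring

theorem norm_monomial_sub_le {P Q P' Q' : A} {R δ : ℝ} (hP : ‖P‖ ≤ R) (hQ : ‖Q‖ ≤ R)
    (hP' : ‖P'‖ ≤ R) (hQ' : ‖Q'‖ ≤ R) (hδP : ‖P - P'‖ ≤ δ) (hδQ : ‖Q - Q'‖ ≤ δ) (a b : ℕ) :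
    R * ‖P ^ a * Q ^ b - P' ^ a * Q' ^ b‖ ≤ (a + b : ℕ) * R ^ (a + b) * δ := by
  have hR : 0 ≤ R := (norm_nonneg P).trans hP
  have h : P ^ a * Q ^ b - P' ^ a * Q' ^ b =
      (P ^ a - P' ^ a) * Q ^ b + P' ^ a * (Q ^ b - Q' ^ b) := by ring
  have hQb : ‖Q ^ b‖ ≤ R ^ b := (norm_pow_le _ _).trans (by gcongr)
  have hPa : ‖P' ^ a‖ ≤ R ^ a := (norm_pow_le _ _).trans (by gcongr)
  calc R * ‖P ^ a * Q ^ b - P' ^ a * Q' ^ b‖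
      ≤ R * (‖P ^ a - P' ^ a‖ * R ^ b + R ^ a * ‖Q ^ b - Q' ^ b‖) := by
        rw [h]
        gcongr
        exact (norm_add_le _ _).trans (add_le_add ((norm_mul_le _ _).trans (by gcongr))
          ((norm_mul_le _ _).trans (by gcongr)))
    _ = (R * ‖P ^ a - P' ^ a‖) * R ^ b + R ^ a * (R * ‖Q ^ b - Q' ^ b‖) := by ring
    _ ≤ (a * R ^ a * δ) * R ^ b + R ^ a * (b * R ^ b * δ) := by
        refine add_le_add (mul_le_mul_of_nonneg_right ?_ (by positivity))
          (mul_le_mul_of_nonneg_left ?_ (by positivity))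
        · exact (norm_pow_sub_pow_le_of_le hP hP' a).trans (by gcongr)
        · exact (norm_pow_sub_pow_le_of_le hQ hQ' b).trans (by gcongr)
    _ = _ := by push_cast; ring

theorem hasSum_half_pow_prod :
    HasSum (fun i : ℕ × ℕ => (1 / 2 : ℝ) ^ i.1 * (1 / 2 : ℝ) ^ i.2) 4 := by
  have h := hasSum_geometric_two
  have := h.mul h (summable_geometric_two.mul_of_nonneg summable_geometric_two
    (fun _ => by positivity) (fun _ => by positivity))
  norm_num at this ⊢
  exact this

theorem QuadraticCoeffs.norm_term_le (hc : QuadraticCoeffs c B r₀) (hR : 0 < R)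
    (hRr : 4 * R ≤ r₀) {P Q : A} (hP : ‖P‖ ≤ R) (hQ : ‖Q‖ ≤ R) (i : ℕ × ℕ) :
    ‖c i * (P ^ i.1 * Q ^ i.2)‖ ≤ 16 * B * R ^ 2 * ((1 / 2) ^ i.1 * (1 / 2) ^ i.2) := by
  have hB := hc.nonneg (by linarith)
  calc ‖c i * (P ^ i.1 * Q ^ i.2)‖ ≤ ‖c i‖ * R ^ (i.1 + i.2) :=
        (norm_mul_le _ _).trans (by gcongr; exact norm_monomial_le hP hQ _ _)
    _ ≤ 16 * B * R ^ 2 * (1 / 4) ^ (i.1 + i.2) := hc.norm_mul_pow_le hR hRr i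
    _ ≤ 16 * B * R ^ 2 * (1 / 2) ^ (i.1 + i.2) := by gcongr; norm_num
    _ = _ := by rw [pow_add]

theorem QuadraticCoeffs.norm_term_sub_le (hc : QuadraticCoeffs c B r₀) (hR : 0 < R)
    (hRr : 4 * R ≤ r₀) {P Q P' Q' : A} {δ : ℝ} (hP : ‖P‖ ≤ R) (hQ : ‖Q‖ ≤ R)
    (hP' : ‖P'‖ ≤ R) (hQ' : ‖Q'‖ ≤ R) (hδP : ‖P - P'‖ ≤ δ) (hδQ : ‖Q - Q'‖ ≤ δ) (i : ℕ × ℕ) :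
    ‖c i * (P ^ i.1 * Q ^ i.2) - c i * (P' ^ i.1 * Q' ^ i.2)‖ ≤
      16 * B * R * δ * ((1 / 2) ^ i.1 * (1 / 2) ^ i.2) := by
  have hB := hc.nonneg (by linarith)
  have hδ : 0 ≤ δ := (norm_nonneg _).trans hδP
  rw [← mul_sub, ← pow_add]
  refine le_of_mul_le_mul_left ?_ hR
  -- Half of the decay `4^{-n}` absorbs the factor `n ≤ 2^n` produced by the difference of
  -- monomials; the other half keeps the series summable.
  have h2 : ((i.1 + i.2 : ℕ) : ℝ) * (1 / 4) ^ (i.1 + i.2) ≤ (1 / 2) ^ (i.1 + i.2) := by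
    have : ((i.1 + i.2 : ℕ) : ℝ) ≤ 2 ^ (i.1 + i.2) := by
      exact_mod_cast Nat.lt_two_pow_self.le
    calc ((i.1 + i.2 : ℕ) : ℝ) * (1 / 4) ^ (i.1 + i.2)
        ≤ 2 ^ (i.1 + i.2) * (1 / 4) ^ (i.1 + i.2) := by gcongr
      _ = _ := by rw [← mul_pow]; norm_num
  calc R * ‖c i * (P ^ i.1 * Q ^ i.2 - P' ^ i.1 * Q' ^ i.2)‖
      ≤ R * (‖c i‖ * ‖P ^ i.1 * Q ^ i.2 - P' ^ i.1 * Q' ^ i.2‖) := by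
        gcongr; exact norm_mul_le _ _
    _ = ‖c i‖ * (R * ‖P ^ i.1 * Q ^ i.2 - P' ^ i.1 * Q' ^ i.2‖) := by ring
    _ ≤ ‖c i‖ * ((i.1 + i.2 : ℕ) * R ^ (i.1 + i.2) * δ) := by
        exact mul_le_mul_of_nonneg_left (norm_monomial_sub_le hP hQ hP' hQ' hδP hδQ _ _)
          (norm_nonneg _)
    _ = (i.1 + i.2 : ℕ) * δ * (‖c i‖ * R ^ (i.1 + i.2)) := by ring
    _ ≤ (i.1 + i.2 : ℕ) * δ * (16 * B * R ^ 2 * (1 / 4) ^ (i.1 + i.2)) := by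
        exact mul_le_mul_of_nonneg_left (hc.norm_mul_pow_le hR hRr i) (by positivity)
    _ = (16 * B * R ^ 2 * δ) * ((i.1 + i.2 : ℕ) * (1 / 4) ^ (i.1 + i.2)) := by ring
    _ ≤ (16 * B * R ^ 2 * δ) * (1 / 2) ^ (i.1 + i.2) := by gcongr
    _ = _ := by ring

theorem QuadraticCoeffs.norm_psEval_le (hc : QuadraticCoeffs c B r₀) (hR : 0 < R)
    (hRr : 4 * R ≤ r₀) {P Q : A} (hP : ‖P‖ ≤ R) (hQ : ‖Q‖ ≤ R) :
    ‖psEval c P Q‖ ≤ 64 * B * R ^ 2 := by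
  refine (tsum_of_norm_bounded (hasSum_half_pow_prod.mul_left _)
    (hc.norm_term_le hR hRr hP hQ)).trans_eq ?_
  ring

variable [CompleteSpace A]

theorem QuadraticCoeffs.hasSum (hc : QuadraticCoeffs c B r₀) (hR : 0 < R)
    (hRr : 4 * R ≤ r₀) {P Q : A} (hP : ‖P‖ ≤ R) (hQ : ‖Q‖ ≤ R) :
    HasSum (fun i => c i * (P ^ i.1 * Q ^ i.2)) (psEval c P Q) :=
  (Summable.of_norm_bounded (hasSum_half_pow_prod.summable.mul_left _)
    (hc.norm_term_le hR hRr hP hQ)).hasSum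

theorem QuadraticCoeffs.norm_psEval_sub_le (hc : QuadraticCoeffs c B r₀) (hR : 0 < R)
    (hRr : 4 * R ≤ r₀) {P Q P' Q' : A} {δ : ℝ} (hP : ‖P‖ ≤ R) (hQ : ‖Q‖ ≤ R)
    (hP' : ‖P'‖ ≤ R) (hQ' : ‖Q'‖ ≤ R) (hδP : ‖P - P'‖ ≤ δ) (hδQ : ‖Q - Q'‖ ≤ δ) :
    ‖psEval c P Q - psEval c P' Q'‖ ≤ 64 * B * R * δ := by
  rw [← ((hc.hasSum hR hRr hP hQ).sub (hc.hasSum hR hRr hP' hQ')).tsum_eq]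
  refine (tsum_of_norm_bounded (hasSum_half_pow_prod.mul_left _)
    (hc.norm_term_sub_le hR hRr hP hQ hP' hQ' hδP hδQ)).trans_eq ?_
  ring

end PowerSeries

/-! ### Directional derivatives of holomorphic functions -/

section Directional

variable {E : Type*} [NormedAddCommGroup E] [NormedSpace ℂ E]

/-- The complex derivative of `G` in the direction `v`. -/
def dirDeriv (v : E) (G : E → ℂ) (z : E) : ℂ := fderiv ℂ G z v

variable {U : Set E} {G : E → ℂ} {v : E}

theorem analyticOnNhd_dirDeriv (hG : AnalyticOnNhd ℂ G U) (v : E) :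
    AnalyticOnNhd ℂ (dirDeriv v G) U :=
  (ContinuousLinearMap.apply ℂ ℂ v).comp_analyticOnNhd hG.fderiv

theorem analyticOnNhd_dirDeriv_iterate (hG : AnalyticOnNhd ℂ G U) (v : E) (n : ℕ) :
    AnalyticOnNhd ℂ ((dirDeriv v)^[n] G) U := by
  induction n with
  | zero => exact hG
  | succ n ih => rw [Function.iterate_succ_apply']; exact analyticOnNhd_dirDeriv ih v

theorem hasDerivAt_line (hG : AnalyticOnNhd ℂ G U) {z : E} {t : ℂ}
    (h : z + t • v ∈ U) :
    HasDerivAt (fun t : ℂ => G (z + t • v)) (dirDeriv v G (z + t • v)) t := by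
  have h1 : HasDerivAt (fun t : ℂ => z + t • v) v t := by
    simpa using ((hasDerivAt_id t).smul_const v).const_add z
  exact (hG _ h).differentiableAt.hasFDerivAt.comp_hasDerivAt t h1

/-- Restriction to a complex line makes the one-variable Cauchy estimates and Taylor series
available for directional derivatives. -/
theorem iteratedDeriv_line (hU : IsOpen U) (hG : AnalyticOnNhd ℂ G U) (z : E) (n : ℕ) :
    ∀ t : ℂ, z + t • v ∈ U →
      iteratedDeriv n (fun t : ℂ => G (z + t • v)) t = (dirDeriv v)^[n] G (z + t • v) := by
  induction n with
  | zero => intro t _; simp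
  | succ n ih =>
    intro t ht
    have hcont : Continuous fun t : ℂ => z + t • v := by fun_prop
    have hev : iteratedDeriv n (fun t : ℂ => G (z + t • v)) =ᶠ[nhds t]
        fun t => (dirDeriv v)^[n] G (z + t • v) := by
      filter_upwards [(hU.preimage hcont).mem_nhds ht] with s hs using ih s hs
    rw [iteratedDeriv_succ, hev.deriv_eq, Function.iterate_succ_apply']
    exact (hasDerivAt_line (analyticOnNhd_dirDeriv_iterate hG v n) ht).deriv

theorem norm_dirDeriv_iterate_le (hU : IsOpen U) (hG : AnalyticOnNhd ℂ G U) {z : E} {ρ B : ℝ}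
    (hρ : 0 < ρ) (hmem : ∀ t : ℂ, ‖t‖ ≤ ρ → z + t • v ∈ U)
    (hB : ∀ t : ℂ, ‖t‖ ≤ ρ → ‖G (z + t • v)‖ ≤ B) (n : ℕ) :
    ‖(dirDeriv v)^[n] G z‖ ≤ n.factorial * B / ρ ^ n := by
  have h0 : iteratedDeriv n (fun t : ℂ => G (z + t • v)) 0 = (dirDeriv v)^[n] G z := by
    have := iteratedDeriv_line (v := v) hU hG z n 0 (hmem 0 (by simpa using hρ.le))
    simpa using this
  rw [← h0]
  refine Complex.norm_iteratedDeriv_le_of_forall_mem_sphere_norm_le n hρ ?_ fun t ht =>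
    hB t (by simpa using (mem_sphere_zero_iff_norm.1 ht).le)
  refine DifferentiableOn.diffContOnCl fun t ht => ?_
  rw [closure_ball _ hρ.ne', mem_closedBall_zero_iff] at ht
  exact (hasDerivAt_line hG (hmem t ht)).differentiableAt.differentiableWithinAt

theorem hasSum_taylor_line (hU : IsOpen U) (hG : AnalyticOnNhd ℂ G U) {z : E} {ρ : ℝ}
    (hmem : ∀ t : ℂ, ‖t‖ < ρ → z + t • v ∈ U) {t : ℂ} (ht : ‖t‖ < ρ) :
    HasSum (fun n : ℕ => (dirDeriv v)^[n] G z / n.factorial * t ^ n) (G (z + t • v)) := by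
  have hd : DifferentiableOn ℂ (fun t : ℂ => G (z + t • v)) (Metric.ball 0 ρ) := fun s hs =>
    (hasDerivAt_line hG
      (hmem s (by simpa using hs))).differentiableAt.differentiableWithinAt
  have h := Complex.hasSum_taylorSeries_on_ball hd (z := t) (by simpa using ht)
  refine h.congr_fun fun n => ?_
  have h0 : iteratedDeriv n (fun t : ℂ => G (z + t • v)) 0 = (dirDeriv v)^[n] G z := by
    have := iteratedDeriv_line (v := v) hU hG z n 0
      (hmem 0 (by simpa using (norm_nonneg t).trans_lt ht))
    simpa using this
  rw [h0, sub_zero, smul_eq_mul, smul_eq_mul]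
  ring

theorem dirDeriv_iterate_add (hU : IsOpen U) {τ : E}
    (hper : ∀ z ∈ U, G (z + τ) = G z) (v : E) (n : ℕ) :
    ∀ z ∈ U, (dirDeriv v)^[n] G (z + τ) = (dirDeriv v)^[n] G z := by
  induction n with
  | zero => exact hper
  | succ n ih =>
    intro z hz
    rw [Function.iterate_succ_apply']
    have hev : (fun z => (dirDeriv v)^[n] G (z + τ)) =ᶠ[nhds z] (dirDeriv v)^[n] G := by
      filter_upwards [hU.mem_nhds hz] with w hw using ih w hw
    have := hev.fderiv_eq (𝕜 := ℂ)
    rw [fderiv_comp_add_right] at this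
    exact congrArg (fun T => T v) this

end Directional

/-! ### The Taylor coefficients of the nonlinearity -/

theorem isOpen_tube (ρ : ℝ) : IsOpen (tube ρ) := by
  have h1 : Continuous fun z : (ℂ × ℂ) × (ℂ × ℂ) => |z.1.1.im| := by fun_prop
  have h2 : Continuous fun z : (ℂ × ℂ) × (ℂ × ℂ) => |z.1.2.im| := by fun_prop
  have h3 : Continuous fun z : (ℂ × ℂ) × (ℂ × ℂ) => ‖z.2‖ := by fun_prop
  exact (isOpen_lt h1 continuous_const).inter
    ((isOpen_lt h2 continuous_const).inter (isOpen_lt h3 continuous_const))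

/-- The coefficient of `ξ₁ⁱ ξ₂ʲ`, times `i! j!`, in the Taylor expansion of `F(x, ξ)`,
as a function of `(x, ξ)`. -/
def derivCoeff (F : (ℂ × ℂ) × (ℂ × ℂ) → ℂ) (i : ℕ × ℕ) : (ℂ × ℂ) × (ℂ × ℂ) → ℂ :=
  (dirDeriv (0, (0, 1)))^[i.2] ((dirDeriv (0, (1, 0)))^[i.1] F)

/-- The Taylor coefficients of the nonlinearity at the zero section. -/
def taylorCoeff (F : (ℂ × ℂ) × (ℂ × ℂ) → ℂ) (i : ℕ × ℕ) (x : ℂ) : ℂ :=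
  derivCoeff F i (toC2 x, 0) / (i.1.factorial * i.2.factorial)

namespace IsNonlinearity

variable {M : ℝ} {e₁ e₂ : ℂ} {F : (ℂ × ℂ) × (ℂ × ℂ) → ℂ}

theorem analytic_derivCoeff (hF : IsNonlinearity M e₁ e₂ F) (i : ℕ × ℕ) :
    AnalyticOnNhd ℂ (derivCoeff F i) (tube (1 / M)) :=
  analyticOnNhd_dirDeriv_iterate (analyticOnNhd_dirDeriv_iterate hF.holomorphic _ _) _ _

/-- Cauchy's estimate is applied in `ξ₁` with `ξ₂ = t` fixed, then in `ξ₂`. For the sup norm on `ℂ ×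
ℂ` the bidisc of radius `r` is the ball of radius `r`, so `|F| ≤ M r²` on all of it. -/
theorem norm_derivCoeff_le (hF : IsNonlinearity M e₁ e₂ F) (hM : 1 ≤ M) (i : ℕ × ℕ)
    {x : ℂ × ℂ} (h1 : |x.1.im| < 1 / M) (h2 : |x.2.im| < 1 / M) {r : ℝ} (hr : 0 < r)
    (hrM : r < 1 / M) :
    ‖derivCoeff F i (x, 0)‖ ≤
      i.2.factorial * (i.1.factorial * (M * r ^ 2) / r ^ i.1) / r ^ i.2 := by
  have hmem : ∀ s t : ℂ, ‖s‖ ≤ r → ‖t‖ ≤ r → (x, (s, t)) ∈ tube (1 / M) := fun s t hs ht =>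
    ⟨h1, h2, (max_le hs ht).trans_lt hrM⟩
  refine norm_dirDeriv_iterate_le (isOpen_tube _)
    (analyticOnNhd_dirDeriv_iterate hF.holomorphic _ _) hr (fun t ht => ?_) (fun t ht => ?_) _
  · simpa using hmem 0 t (by simpa using hr.le) ht
  · refine norm_dirDeriv_iterate_le (isOpen_tube _) hF.holomorphic hr (fun s hs => ?_)
      (fun s hs => ?_) _
    · simpa using hmem s t hs ht
    · have h := hF.bound x (s, t) (hmem s t hs ht)
      have : M * ‖((s, t) : ℂ × ℂ)‖ ^ 2 ≤ M * r ^ 2 := by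
        gcongr; exact max_le hs ht
      simpa using h.trans this

/-- A shift of `x` by `t e` with `|t| ≤ 1 / (2 M²)` and `|e| ≤ M` moves the imaginary parts by at
most `1 / (2M)`, half the width of the tube, so Cauchy's estimate on that disc bounds the
derivatives in the direction of a period. -/
theorem norm_dirDeriv_derivCoeff_le (hF : IsNonlinearity M e₁ e₂ F) (hM : 1 ≤ M) (i : ℕ × ℕ)
    (x : ℂ) {e : ℂ} (he : ‖e‖ ≤ M) {r : ℝ} (hr : 0 < r) (hrM : r < 1 / M) (J : ℕ) :
    ‖(dirDeriv (toC2 e, 0))^[J] (derivCoeff F i) (toC2 x, 0)‖ ≤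
      J.factorial * (i.2.factorial * (i.1.factorial * (M * r ^ 2) / r ^ i.1) / r ^ i.2) /
        (1 / (2 * M ^ 2)) ^ J := by
  have hM0 : 0 < M := by linarith
  have him : ∀ (t : ℂ) (y a : ℝ), ‖t‖ ≤ 1 / (2 * M ^ 2) → |a| ≤ M →
      |((y : ℂ) + t * a).im| < 1 / M := fun t y a ht ha => by
    have h1 : ((y : ℂ) + t * a).im = t.im * a := by simp
    rw [h1, abs_mul]
    calc |t.im| * |a| ≤ 1 / (2 * M ^ 2) * M :=
          mul_le_mul ((Complex.abs_im_le_norm t).trans ht) ha (abs_nonneg _) (by positivity)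
      _ = 1 / M / 2 := by field_simp
      _ < 1 / M := half_lt_self (by positivity)
  have hre := (Complex.abs_re_le_norm e).trans he
  have him' := (Complex.abs_im_le_norm e).trans he
  refine norm_dirDeriv_iterate_le (isOpen_tube _) (hF.analytic_derivCoeff i) (by positivity)
    (fun t ht => ?_) (fun t ht => ?_) J
  · have := hr.trans hrM
    exact ⟨him t _ _ ht hre, him t _ _ ht him', by simpa using this⟩
  · have := hF.norm_derivCoeff_le hM i (x := toC2 x + t • toC2 e) (him t _ _ ht hre)
      (him t _ _ ht him') hr hrM
    simpa using this

theorem real_mem_tube (hM : 1 ≤ M) (x : ℂ) {ξ : ℂ × ℂ} (hξ : ‖ξ‖ < 1 / M) :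
    (toC2 x, ξ) ∈ tube (1 / M) := by
  have : 0 < 1 / M := by positivity
  exact ⟨by simpa [toC2] using this, by simpa [toC2] using this, hξ⟩

theorem zero_mem_tube (hM : 1 ≤ M) (x : ℂ) : (toC2 x, 0) ∈ tube (1 / M) :=
  real_mem_tube hM x (by rw [norm_zero]; positivity)

/-- Radius `1 / (2M)` keeps the closed discs inside the open tube. All smaller radii are allowed
too, and letting them tend to 0 forces the terms of degree below 2 to vanish. -/
theorem quadraticCoeffs_taylorCoeff (hF : IsNonlinearity M e₁ e₂ F) (hM : 1 ≤ M) (x : ℂ) :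
    QuadraticCoeffs (fun i => taylorCoeff F i x) M (1 / (2 * M)) where
  bound i r hr hr0 := by
    have hrM : r < 1 / M := hr0.trans_lt (by
      rw [one_div_lt_one_div (by positivity) (by positivity)]; linarith)
    have hpos : 0 < 1 / M := by positivity
    have h := hF.norm_derivCoeff_le hM i (x := toC2 x) (by simpa [toC2] using hpos)
      (by simpa [toC2] using hpos) hr hrM
    rw [taylorCoeff, norm_div, norm_mul, Complex.norm_natCast, Complex.norm_natCast, pow_add]
    calc _ ≤ i.2.factorial * (i.1.factorial * (M * r ^ 2) / r ^ i.1) / r ^ i.2 /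
          (i.1.factorial * i.2.factorial) * (r ^ i.1 * r ^ i.2) := by gcongr
      _ = M * r ^ 2 := by
        have := Nat.factorial_ne_zero i.1
        have := Nat.factorial_ne_zero i.2
        field_simp

/-- One-variable Taylor expansions, in `ξ₂` for each power of `ξ₁` and then in `ξ₁`, give an
iterated sum; it agrees with the double sum because the latter converges. -/
theorem psEval_taylorCoeff (hF : IsNonlinearity M e₁ e₂ F) (hM : 1 ≤ M) (x : ℂ) {R : ℝ}
    (hR : 0 < R) (hRM : 4 * R ≤ 1 / (2 * M)) {s t : ℂ} (hs : ‖s‖ ≤ R) (ht : ‖t‖ ≤ R) :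
    psEval (fun i => taylorCoeff F i x) s t = F (toC2 x, (s, t)) := by
  have hR1 : R < 1 / M := by
    have h2 : 1 / (2 * M) = 1 / M / 2 := by ring
    have : 0 < 1 / M := by positivity
    linarith
  have hmem : ∀ s t : ℂ, ‖s‖ < 1 / M → ‖t‖ < 1 / M → (toC2 x, (s, t)) ∈ tube (1 / M) :=
    fun s t hs ht => real_mem_tube hM x (max_lt hs ht)
  have hsum := (hF.quadraticCoeffs_taylorCoeff hM x).hasSum hR hRM hs ht
  have hin : ∀ i : ℕ, HasSum (fun j => taylorCoeff F (i, j) x * (s ^ i * t ^ j))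
      ((dirDeriv (0, (1, 0)))^[i] F (toC2 x, (0, t)) / i.factorial * s ^ i) := fun i => by
    have h := hasSum_taylor_line (v := (0, (0, 1))) (z := (toC2 x, 0)) (isOpen_tube _)
      (analyticOnNhd_dirDeriv_iterate hF.holomorphic (0, (1, 0)) i)
      (fun t ht => by simpa using hmem 0 t (by simpa using hR.trans hR1) ht) (ht.trans_lt hR1)
    have h' := h.mul_right ((i.factorial : ℂ)⁻¹ * s ^ i)
    have hz : ((toC2 x, 0) : (ℂ × ℂ) × (ℂ × ℂ)) + t • (0, (0, 1)) = (toC2 x, (0, t)) := by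
      simp
    rw [hz] at h'
    rw [div_mul_eq_mul_div, mul_div_assoc, div_eq_inv_mul]
    refine h'.congr_fun fun j => ?_
    rw [taylorCoeff, derivCoeff]
    have := Nat.factorial_ne_zero i
    have := Nat.factorial_ne_zero j
    field_simp
  have hout := hasSum_taylor_line (v := (0, (1, 0))) (z := (toC2 x, (0, t)))
    (isOpen_tube _) hF.holomorphic
    (fun s hs => by simpa using hmem s t hs (ht.trans_lt hR1)) (hs.trans_lt hR1)
  have h := (hsum.prod_fiberwise hin).unique hout
  simpa using h

theorem latticePeriodic_dirDeriv (hF : IsNonlinearity M e₁ e₂ F) (hM : 1 ≤ M) (i : ℕ × ℕ)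
    (v : (ℂ × ℂ) × (ℂ × ℂ)) (j : ℕ) :
    LatticePeriodic e₁ e₂ fun x => (dirDeriv v)^[j] (derivCoeff F i) (toC2 x, 0) := by
  have key : ∀ e : ℂ, (∀ x ξ, (x, ξ) ∈ tube (1 / M) → F (x + toC2 e, ξ) = F (x, ξ)) →
      Function.Periodic (fun x => (dirDeriv v)^[j] (derivCoeff F i) (toC2 x, 0)) e := by
    intro e he x
    have h0 : ∀ z ∈ tube (1 / M), F (z + (toC2 e, 0)) = F z := by
      rintro ⟨x, ξ⟩ hz
      simpa using he x ξ hz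
    have h := dirDeriv_iterate_add (isOpen_tube _) (dirDeriv_iterate_add (isOpen_tube _)
      (dirDeriv_iterate_add (isOpen_tube _) h0 (0, (1, 0)) i.1) (0, (0, 1)) i.2) v j
      _ (zero_mem_tube hM x)
    rw [← derivCoeff] at h
    have hadd : toC2 (x + e) = toC2 x + toC2 e := by simp [toC2]
    simpa [hadd] using h
  exact ⟨key e₁ hF.periodic_fst, key e₂ hF.periodic_snd⟩

theorem hasDerivAt_dirDeriv (hF : IsNonlinearity M e₁ e₂ F) (hM : 1 ≤ M) (i : ℕ × ℕ)
    (e : ℂ) (j : ℕ) (x : ℂ) :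
    HasDerivAt (fun s : ℝ => (dirDeriv (toC2 e, 0))^[j] (derivCoeff F i) (toC2 (x + s * e), 0))
      ((dirDeriv (toC2 e, 0))^[j + 1] (derivCoeff F i) (toC2 x, 0)) 0 := by
  have h := hasDerivAt_line (v := (toC2 e, (0 : ℂ × ℂ))) (z := (toC2 x, 0)) (t := 0)
    (analyticOnNhd_dirDeriv_iterate (hF.analytic_derivCoeff i) (toC2 e, 0) j)
    (by simpa using zero_mem_tube hM x)
  have h2 := HasDerivAt.comp_ofReal (z := 0) (by simpa using h)
  rw [Function.iterate_succ_apply']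
  convert h2 using 3 with s
  simp [toC2]

theorem continuous_dirDeriv (hF : IsNonlinearity M e₁ e₂ F) (hM : 1 ≤ M) (i : ℕ × ℕ)
    (v : (ℂ × ℂ) × (ℂ × ℂ)) (j : ℕ) :
    Continuous fun x : ℂ => (dirDeriv v)^[j] (derivCoeff F i) (toC2 x, 0) := by
  have h1 := (analyticOnNhd_dirDeriv_iterate (hF.analytic_derivCoeff i) v j).continuousOn
  refine h1.comp_continuous ?_ fun x => zero_mem_tube hM x
  unfold toC2
  fun_prop

end IsNonlinearity

/-! ### Lattice coordinates and characters -/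

/-- The signed area of the period parallelogram. -/
def cellArea (e₁ e₂ : ℂ) : ℝ := ((starRingEnd ℂ) e₁ * e₂).im

/-- The coordinates with respect to the basis `e₁, e₂`. -/
def coord (e₁ e₂ : ℂ) : Fin 2 → ℂ →L[ℝ] ℝ :=
  ![(e₂.im / cellArea e₁ e₂) • Complex.reCLM - (e₂.re / cellArea e₁ e₂) • Complex.imCLM,
    (e₁.re / cellArea e₁ e₂) • Complex.imCLM - (e₁.im / cellArea e₁ e₂) • Complex.reCLM]

section Coordinates

variable {e₁ e₂ : ℂ}

theorem cellArea_eq : cellArea e₁ e₂ = e₁.re * e₂.im - e₁.im * e₂.re := by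
  simp [cellArea]; ring

theorem coord_zero_apply (x : ℂ) :
    coord e₁ e₂ 0 x = (x.re * e₂.im - x.im * e₂.re) / cellArea e₁ e₂ := by
  simp [coord]; ring

theorem coord_one_apply (x : ℂ) :
    coord e₁ e₂ 1 x = (e₁.re * x.im - e₁.im * x.re) / cellArea e₁ e₂ := by
  simp [coord]; ring

theorem coord_combination (hA : cellArea e₁ e₂ ≠ 0) (s t : ℝ) :
    coord e₁ e₂ 0 (s * e₁ + t * e₂) = s ∧ coord e₁ e₂ 1 (s * e₁ + t * e₂) = t := by
  rw [coord_zero_apply, coord_one_apply, div_eq_iff hA, div_eq_iff hA, cellArea_eq]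
  simp
  constructor <;> ring

theorem coord_basis (hA : cellArea e₁ e₂ ≠ 0) (i j : Fin 2) :
    coord e₁ e₂ i (![e₁, e₂] j) = (Pi.single j 1 : Fin 2 → ℝ) i := by
  have h1 := coord_combination hA 1 0
  have h2 := coord_combination hA 0 1
  simp at h1 h2
  fin_cases i <;> fin_cases j <;> simp [h1, h2]

theorem eq_combination (hA : cellArea e₁ e₂ ≠ 0) (x : ℂ) :
    x = coord e₁ e₂ 0 x * e₁ + coord e₁ e₂ 1 x * e₂ := by
  rw [coord_zero_apply, coord_one_apply]
  have h := cellArea_eq (e₁ := e₁) (e₂ := e₂)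
  apply Complex.ext <;> simp <;> field_simp <;> rw [h] <;> ring

/-- The linear form `x ↦ ∑ nᵢ xᵢ` in lattice coordinates. -/
def dualForm (e₁ e₂ : ℂ) (n : Fin 2 → ℤ) : ℂ →L[ℝ] ℝ :=
  (n 0 : ℝ) • coord e₁ e₂ 0 + (n 1 : ℝ) • coord e₁ e₂ 1

/-- The characters of the torus. -/
def character (e₁ e₂ : ℂ) (n : Fin 2 → ℤ) (x : ℂ) : ℂ :=
  Complex.exp (2 * Real.pi * Complex.I * dualForm e₁ e₂ n x)

theorem character_zero (x : ℂ) : character e₁ e₂ 0 x = 1 := by simp [character, dualForm]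

theorem character_add (m n : Fin 2 → ℤ) (x : ℂ) :
    character e₁ e₂ (m + n) x = character e₁ e₂ m x * character e₁ e₂ n x := by
  rw [character, character, character, ← Complex.exp_add]
  congr 1
  simp [dualForm]
  ring

theorem norm_character (n : Fin 2 → ℤ) (x : ℂ) : ‖character e₁ e₂ n x‖ = 1 := by
  rw [character, mul_right_comm, ← Complex.ofReal_ofNat, ← Complex.ofReal_mul,
    ← Complex.ofReal_mul, Complex.norm_exp_ofReal_mul_I]

/-- Evaluation of a Fourier series at a point, as an algebra homomorphism. -/
def Wiener.evalHom {k : ℕ} (e₁ e₂ x : ℂ) : Wiener k →ₐ[ℂ] ℂ :=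
  charHom (fun n => character e₁ e₂ n x) (character_zero x) (fun m n => character_add m n x)
    fun n => (norm_character n x).le

theorem Wiener.hasSum_evalHom {k : ℕ} (e₁ e₂ x : ℂ) (f : Wiener k) :
    HasSum (fun n => coeff f n * character e₁ e₂ n x) (evalHom e₁ e₂ x f) :=
  hasSum_charHom _ _ _ _ f

theorem Wiener.norm_evalHom_le {k : ℕ} (e₁ e₂ x : ℂ) (f : Wiener k) :
    ‖evalHom e₁ e₂ x f‖ ≤ ‖f‖ :=
  norm_charHom_le _ _ _ _ f

theorem latticePeriodic_iff {E : Type*} {f : ℂ → E} :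
    LatticePeriodic e₁ e₂ f ↔ ∀ i, Function.Periodic f (![e₁, e₂] i) := by
  rw [Fin.forall_fin_two]; rfl

theorem hasDerivAt_character_line (hA : cellArea e₁ e₂ ≠ 0) (n : Fin 2 → ℤ) (i : Fin 2) (x : ℂ) :
    HasDerivAt (fun s : ℝ => character e₁ e₂ n (x + s * ![e₁, e₂] i))
      (2 * Real.pi * Complex.I * n i * character e₁ e₂ n x) 0 := by
  have hform : ∀ s : ℝ, dualForm e₁ e₂ n (x + s * ![e₁, e₂] i) = dualForm e₁ e₂ n x + s * n i := by
    intro s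
    rw [map_add, ← Complex.real_smul, map_smul]
    simp only [dualForm, add_apply, smul_apply, coord_basis hA, smul_eq_mul]
    fin_cases i <;> simp
  have h1 : HasDerivAt (fun s : ℝ => (2 * Real.pi * Complex.I) *
      ((dualForm e₁ e₂ n x : ℂ) + (s : ℂ) * n i)) (2 * Real.pi * Complex.I * n i) 0 := by
    have := (((hasDerivAt_id (0 : ℝ)).ofReal_comp.mul_const (n i : ℂ)).const_add
      (dualForm e₁ e₂ n x : ℂ)).const_mul (2 * Real.pi * Complex.I)
    simpa using this
  have h2 := h1.cexp
  simp only [character, hform]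
  convert h2 using 1
  · ext s; push_cast; rfl
  · simp; ring

theorem character_periodic (hA : cellArea e₁ e₂ ≠ 0) (n : Fin 2 → ℤ) :
    LatticePeriodic e₁ e₂ (character e₁ e₂ n) := by
  refine latticePeriodic_iff.2 fun i x => ?_
  have hform : dualForm e₁ e₂ n (x + ![e₁, e₂] i) = dualForm e₁ e₂ n x + n i := by
    rw [map_add]
    simp only [dualForm, add_apply, smul_apply, coord_basis hA, smul_eq_mul]
    fin_cases i <;> simp
  rw [character, hform, character, Complex.exp_eq_exp_iff_exists_int]
  exact ⟨n i, by push_cast; ring⟩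

theorem continuous_character (n : Fin 2 → ℤ) : Continuous (character e₁ e₂ n) := by
  unfold character; fun_prop

end Coordinates

/-! ### Fourier coefficients of lattice periodic functions -/

section Torus

open MeasureTheory UnitAddTorus

attribute [local instance] instMeasureSpaceUnitAddCircle
  instIsAddHaarMeasureUnitAddCircleVolume instIsProbabilityMeasureUnitAddCircleVolume

/-- The projection to the torus `ℝ² / ℤ²` in lattice coordinates. -/
def toTorus (e₁ e₂ x : ℂ) : UnitAddTorus (Fin 2) := fun i => (coord e₁ e₂ i x : UnitAddCircle)

/-- Lattice coordinates as a homeomorphism. -/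
def coordHomeo {e₁ e₂ : ℂ} (hA : cellArea e₁ e₂ ≠ 0) : ℂ ≃ₜ (Fin 2 → ℝ) where
  toFun x i := coord e₁ e₂ i x
  invFun y := y 0 * e₁ + y 1 * e₂
  left_inv x := (eq_combination hA x).symm
  right_inv y := by
    ext i
    fin_cases i
    · exact (coord_combination hA _ _).1
    · exact (coord_combination hA _ _).2
  continuous_toFun := by fun_prop
  continuous_invFun := by fun_prop

variable {e₁ e₂ : ℂ}

theorem isOpenQuotientMap_toTorus (hA : cellArea e₁ e₂ ≠ 0) : IsOpenQuotientMap (toTorus e₁ e₂) :=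
  (IsOpenQuotientMap.piMap fun _ : Fin 2 =>
    (QuotientAddGroup.isOpenQuotientMap_mk (N := AddSubgroup.zmultiples (1 : ℝ)))).comp
    (coordHomeo hA).isOpenQuotientMap

theorem toTorus_add (x y : ℂ) : toTorus e₁ e₂ (x + y) = toTorus e₁ e₂ x + toTorus e₁ e₂ y := by
  ext i; simp [toTorus]

theorem eq_of_toTorus_eq {E : Type*} {f : ℂ → E} (hA : cellArea e₁ e₂ ≠ 0)
    (hf : LatticePeriodic e₁ e₂ f) {x y : ℂ} (h : toTorus e₁ e₂ x = toTorus e₁ e₂ y) :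
    f x = f y := by
  have hn : ∀ i, ∃ n : ℤ, coord e₁ e₂ i (x - y) = n := fun i => by
    have h1 : ((coord e₁ e₂ i (x - y) : ℝ) : UnitAddCircle) = 0 := by
      rw [map_sub, AddCircle.coe_sub, sub_eq_zero]
      exact congrFun h i
    obtain ⟨n, hn⟩ := (AddCircle.coe_eq_zero_iff (1 : ℝ)).1 h1
    exact ⟨n, by rw [← hn]; simp⟩
  obtain ⟨m, hm⟩ := hn 0
  obtain ⟨n, hn⟩ := hn 1
  have hx : x = y + m • e₁ + n • e₂ := by
    have := eq_combination hA (x - y)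
    rw [hm, hn] at this
    rw [zsmul_eq_mul, zsmul_eq_mul, add_assoc, ← sub_eq_iff_eq_add', this]
    push_cast; rfl
  rw [hx, hf.2.zsmul n, hf.1.zsmul m]

/-- The function on the torus defined by a lattice periodic function. -/
def descend (e₁ e₂ : ℂ) (f : ℂ → ℂ) (θ : UnitAddTorus (Fin 2)) : ℂ :=
  f (Function.invFun (toTorus e₁ e₂) θ)

/-- `Function.invFun` picks an arbitrary preimage; periodicity makes the choice harmless. -/
theorem descend_toTorus (hA : cellArea e₁ e₂ ≠ 0) {f : ℂ → ℂ} (hf : LatticePeriodic e₁ e₂ f)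
    (x : ℂ) : descend e₁ e₂ f (toTorus e₁ e₂ x) = f x :=
  eq_of_toTorus_eq hA hf (Function.invFun_eq ⟨x, rfl⟩)

theorem continuous_descend (hA : cellArea e₁ e₂ ≠ 0) {f : ℂ → ℂ} (hf : LatticePeriodic e₁ e₂ f)
    (hc : Continuous f) : Continuous (descend e₁ e₂ f) := by
  rw [← (isOpenQuotientMap_toTorus hA).continuous_comp_iff]
  exact hc.congr fun x => (descend_toTorus hA hf x).symm

theorem integrable_descend (hA : cellArea e₁ e₂ ≠ 0) {f : ℂ → ℂ} (hf : LatticePeriodic e₁ e₂ f)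
    (hc : Continuous f) : Integrable (descend e₁ e₂ f) :=
  (continuous_descend hA hf hc).integrable_of_hasCompactSupport (HasCompactSupport.of_compactSpace _)

theorem mFourier_toTorus (n : Fin 2 → ℤ) (x : ℂ) :
    mFourier n (toTorus e₁ e₂ x) = character e₁ e₂ n x := by
  simp only [mFourier, ContinuousMap.coe_mk, toTorus, fourier_coe_apply, Fin.prod_univ_two,
    character, ← Complex.exp_add]
  congr 1
  simp [dualForm]
  ring

/-! ### Fourier coefficients and integration by parts. -/

/-- The Fourier coefficients of a lattice periodic function. -/
def fourierC (e₁ e₂ : ℂ) (f : ℂ → ℂ) (n : Fin 2 → ℤ) : ℂ := mFourierCoeff (descend e₁ e₂ f) n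

/-- `f` has the continuous derivative `g` in the direction of the `i`-th period. -/
structure HasPeriodDeriv (e₁ e₂ : ℂ) (i : Fin 2) (f g : ℂ → ℂ) : Prop where
  periodic : LatticePeriodic e₁ e₂ f
  continuous : Continuous f
  periodic' : LatticePeriodic e₁ e₂ g
  continuous' : Continuous g
  deriv : ∀ x, HasDerivAt (fun s : ℝ => f (x + s * ![e₁, e₂] i)) (g x) 0

theorem toTorus_real_mul (hA : cellArea e₁ e₂ ≠ 0) (i : Fin 2) (s : ℝ) :
    toTorus e₁ e₂ (s * ![e₁, e₂] i) = Pi.single i (s : UnitAddCircle) := by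
  ext j
  rw [toTorus, ← Complex.real_smul, map_smul, coord_basis hA]
  rcases eq_or_ne j i with rfl | h
  · simp
  · simp [Pi.single_eq_of_ne h]

/-- By translation invariance the integral of `f(θ + σ s)` does not depend on `s`; differentiating
under the integral sign gives the claim. -/
theorem HasPeriodDeriv.integral_eq_zero (hA : cellArea e₁ e₂ ≠ 0) {i : Fin 2} {f g : ℂ → ℂ}
    (h : HasPeriodDeriv e₁ e₂ i f g) : ∫ θ, descend e₁ e₂ g θ = 0 := by
  set σ : ℝ → UnitAddTorus (Fin 2) := fun s => Pi.single i (s : UnitAddCircle) with hσ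
  have hfc := continuous_descend hA h.periodic h.continuous
  have hgc := continuous_descend hA h.periodic' h.continuous'
  obtain ⟨D, hD⟩ := isCompact_univ.exists_bound_of_continuousOn hgc.continuousOn
  have hint : ∀ s, ∫ θ, descend e₁ e₂ f (θ + σ s) = ∫ θ, descend e₁ e₂ f θ := fun s =>
    integral_add_right_eq_self _ _
  have hderiv : ∀ (θ : UnitAddTorus (Fin 2)) (s : ℝ),
      HasDerivAt (fun s => descend e₁ e₂ f (θ + σ s)) (descend e₁ e₂ g (θ + σ s)) s := by
    intro θ s
    obtain ⟨x, rfl⟩ := (isOpenQuotientMap_toTorus hA).surjective θ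
    have key : ∀ (q : ℂ → ℂ), LatticePeriodic e₁ e₂ q → ∀ s : ℝ,
        descend e₁ e₂ q (toTorus e₁ e₂ x + σ s) = q (x + s * ![e₁, e₂] i) := fun q hq s => by
      rw [hσ]
      simp only
      rw [← toTorus_real_mul hA, ← toTorus_add, descend_toTorus hA hq]
    simp only [key f h.periodic, key g h.periodic']
    have h1 := h.deriv (x + s * ![e₁, e₂] i)
    rw [← sub_self s] at h1
    have h2 := h1.comp_sub_const s s
    refine h2.congr_of_eventuallyEq (Filter.Eventually.of_forall fun r => ?_)
    simp only
    congr 1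
    push_cast
    ring
  have := hasDerivAt_integral_of_dominated_loc_of_deriv_le (μ := (volume : Measure
    (UnitAddTorus (Fin 2)))) (F := fun s θ => descend e₁ e₂ f (θ + σ s))
    (F' := fun s θ => descend e₁ e₂ g (θ + σ s)) (x₀ := 0) (bound := fun _ => D)
    Filter.univ_mem (.of_forall fun s => (by fun_prop : Continuous _).aestronglyMeasurable)
    ((by fun_prop : Continuous fun θ => descend e₁ e₂ f (θ + σ 0)).integrable_of_hasCompactSupport
      (HasCompactSupport.of_compactSpace _))
    (by fun_prop : Continuous _).aestronglyMeasurable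
    (.of_forall fun θ s _ => hD _ (Set.mem_univ _)) (integrable_const D)
    (.of_forall fun θ s _ => hderiv θ s)
  have h2 := this.2
  simp only [hint] at h2
  have h3 := h2.unique (hasDerivAt_const _ _)
  simpa [hσ] using h3

theorem fourierC_eq_integral (hA : cellArea e₁ e₂ ≠ 0) {f : ℂ → ℂ} (n : Fin 2 → ℤ) :
    fourierC e₁ e₂ f n = ∫ θ, descend e₁ e₂ (fun x => character e₁ e₂ (-n) x * f x) θ := by
  rw [fourierC, mFourierCoeff]
  refine integral_congr_ae (.of_forall fun θ => ?_)
  simp only [descend, ← mFourier_toTorus, smul_eq_mul]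
  rw [Function.invFun_eq ((isOpenQuotientMap_toTorus hA).surjective θ)]

theorem fourierC_linear (hA : cellArea e₁ e₂ ≠ 0) {f g : ℂ → ℂ} (hf : LatticePeriodic e₁ e₂ f)
    (hfc : Continuous f) (hg : LatticePeriodic e₁ e₂ g) (hgc : Continuous g) (a b : ℂ)
    (n : Fin 2 → ℤ) : fourierC e₁ e₂ (fun x => a * f x + b * g x) n =
      a * fourierC e₁ e₂ f n + b * fourierC e₁ e₂ g n := by
  have hint : ∀ {q : ℂ → ℂ}, LatticePeriodic e₁ e₂ q → Continuous q →
      Integrable fun θ => mFourier (-n) θ * descend e₁ e₂ q θ := fun hq hqc =>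
    ((mFourier (-n)).continuous.mul
      (continuous_descend hA hq hqc)).integrable_of_hasCompactSupport
      (HasCompactSupport.of_compactSpace _)
  simp only [fourierC, mFourierCoeff, smul_eq_mul]
  rw [← integral_const_mul, ← integral_const_mul,
    ← integral_add ((hint hf hfc).const_mul a) ((hint hg hgc).const_mul b)]
  refine integral_congr_ae (.of_forall fun θ => ?_)
  simp only [descend]
  ring

theorem LatticePeriodic.mul {f g : ℂ → ℂ} (hf : LatticePeriodic e₁ e₂ f)
    (hg : LatticePeriodic e₁ e₂ g) : LatticePeriodic e₁ e₂ fun x => f x * g x :=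
  ⟨hf.1.mul hg.1, hf.2.mul hg.2⟩

/-- Integration by parts: the derivative of the product of `f` with the character of frequency `-n`
has integral zero. -/
theorem HasPeriodDeriv.fourierC_eq (hA : cellArea e₁ e₂ ≠ 0) {i : Fin 2} {f g : ℂ → ℂ}
    (h : HasPeriodDeriv e₁ e₂ i f g) (n : Fin 2 → ℤ) :
    fourierC e₁ e₂ g n = 2 * Real.pi * Complex.I * n i * fourierC e₁ e₂ f n := by
  have hχ := character_periodic hA (-n)
  have hχc := continuous_character (e₁ := e₁) (e₂ := e₂) (-n)
  have hgc := h.continuous'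
  have hfc := h.continuous
  have h0 : HasPeriodDeriv e₁ e₂ i (fun x => character e₁ e₂ (-n) x * f x)
      (fun x => character e₁ e₂ (-n) x * g x -
        2 * Real.pi * Complex.I * n i * (character e₁ e₂ (-n) x * f x)) := by
    refine ⟨hχ.mul h.periodic, hχc.mul hfc, ⟨fun x => ?_, fun x => ?_⟩, by fun_prop, fun x => ?_⟩
    · simp only [hχ.1 x, h.periodic.1 x, h.periodic'.1 x]
    · simp only [hχ.2 x, h.periodic.2 x, h.periodic'.2 x]
    · have := (hasDerivAt_character_line hA (-n) i x).mul (h.deriv x)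
      refine this.congr_deriv ?_
      simp
      ring
  have h1 := h0.integral_eq_zero hA
  have h2 : descend e₁ e₂ (fun x => character e₁ e₂ (-n) x * g x -
        2 * Real.pi * Complex.I * n i * (character e₁ e₂ (-n) x * f x)) = fun θ =>
      descend e₁ e₂ (fun x => character e₁ e₂ (-n) x * g x) θ - 2 * Real.pi * Complex.I * n i *
      descend e₁ e₂ (fun x => character e₁ e₂ (-n) x * f x) θ := rfl
  rw [h2, integral_sub (integrable_descend hA (hχ.mul h.periodic') (hχc.mul hgc))
    ((integrable_descend hA (hχ.mul h.periodic) (hχc.mul hfc)).const_mul _),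
    integral_const_mul, ← fourierC_eq_integral hA, ← fourierC_eq_integral hA, sub_eq_zero] at h1
  exact h1

theorem fourierC_zero (n : Fin 2 → ℤ) : fourierC e₁ e₂ (fun _ => 0) n = 0 := by
  simp [fourierC, mFourierCoeff, descend]

theorem fourierC_const (hA : cellArea e₁ e₂ ≠ 0) (c : ℂ) {n : Fin 2 → ℤ} (hn : n ≠ 0) :
    fourierC e₁ e₂ (fun _ => c) n = 0 := by
  obtain ⟨i, hi⟩ := Function.ne_iff.1 hn
  have h : HasPeriodDeriv e₁ e₂ i (fun _ => c) (fun _ => 0) :=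
    ⟨⟨fun _ => rfl, fun _ => rfl⟩, continuous_const, ⟨fun _ => rfl, fun _ => rfl⟩,
      continuous_const, fun _ => hasDerivAt_const _ _⟩
  have h1 := h.fourierC_eq hA n
  rw [fourierC_zero] at h1
  have h2 : (2 * Real.pi * Complex.I * n i : ℂ) ≠ 0 :=
    mul_ne_zero Complex.two_pi_I_ne_zero (Int.cast_ne_zero.2 hi)
  exact (mul_eq_zero.1 h1.symm).resolve_left h2

/-! ### Decay of Fourier coefficients and membership in the Wiener algebra. -/

theorem norm_fourierC_le {f : ℂ → ℂ} {D : ℝ} (hD : ∀ x, ‖f x‖ ≤ D) (n : Fin 2 → ℤ) :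
    ‖fourierC e₁ e₂ f n‖ ≤ D := by
  rw [fourierC, mFourierCoeff]
  refine (norm_integral_le_of_norm_le_const (C := D) (.of_forall fun θ => ?_)).trans_eq
    (by simp)
  rw [norm_smul]
  refine (mul_le_of_le_one_left (norm_nonneg _) ?_).trans (hD _)
  exact ((mFourier (-n)).norm_coe_le_norm θ).trans_eq mFourier_norm

/-- `h 0, h 1, …` are the successive derivatives of `h 0` in the direction of a period, and
`h J` is bounded by `D`. -/
structure HasPeriodDerivs (e₁ e₂ : ℂ) (i : Fin 2) (J : ℕ) (D : ℝ) (h : ℕ → ℂ → ℂ) : Prop where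
  deriv : ∀ j, HasPeriodDeriv e₁ e₂ i (h j) (h (j + 1))
  bound : ∀ x, ‖h J x‖ ≤ D

theorem HasPeriodDerivs.pow_mul_norm_fourierC_le (hA : cellArea e₁ e₂ ≠ 0) {i : Fin 2} {J : ℕ}
    {D : ℝ} {h : ℕ → ℂ → ℂ} (H : HasPeriodDerivs e₁ e₂ i J D h) (n : Fin 2 → ℤ) :
    ‖n i‖ ^ J * ‖fourierC e₁ e₂ (h 0) n‖ ≤ D := by
  have key : ∀ j, fourierC e₁ e₂ (h j) n =
      (2 * Real.pi * Complex.I * n i) ^ j * fourierC e₁ e₂ (h 0) n := by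
    intro j
    induction j with
    | zero => simp
    | succ j ih => rw [(H.deriv j).fourierC_eq hA, ih]; ring
  have h1 := norm_fourierC_le (e₁ := e₁) (e₂ := e₂) H.bound n
  rw [key, norm_mul, norm_pow] at h1
  refine le_trans ?_ h1
  gcongr
  have h3 : (1 : ℝ) ≤ 2 * Real.pi := by linarith [Real.pi_gt_three]
  have h4 : ‖(2 * Real.pi * Complex.I * n i : ℂ)‖ = 2 * Real.pi * ‖n i‖ := by
    simp [abs_of_pos Real.pi_pos, Int.norm_eq_abs]
  rw [h4]
  exact le_mul_of_one_le_left (norm_nonneg _) h3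

/-- For the sup norm `|n|` equals some `|nᵢ|`, so pure derivatives along the two periods suffice. If
`|n| ≥ 1` the weight is at most `(2|n|)^J`; otherwise it is at most `2^J` and the sup bound of `f`
is enough. -/
theorem wt_mul_norm_fourierC_le (hA : cellArea e₁ e₂ ≠ 0) {J : ℕ} {D : ℝ} {f : ℂ → ℂ}
    (hD : ∀ x, ‖f x‖ ≤ D) {h : Fin 2 → ℕ → ℂ → ℂ} (h0 : ∀ i, h i 0 = f)
    (H : ∀ i, HasPeriodDerivs e₁ e₂ i J D (h i)) (n : Fin 2 → ℤ) :
    wt J n * ‖fourierC e₁ e₂ f n‖ ≤ 2 ^ J * D := by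
  rcases le_total ‖n‖ 1 with h1 | h1
  · refine mul_le_mul ?_ (norm_fourierC_le hD n) (norm_nonneg _) (by positivity)
    exact pow_le_pow_left₀ (by positivity) (by linarith) J
  · obtain ⟨i, hi⟩ : ∃ i, ‖n‖ = ‖n i‖ := by
      obtain ⟨i, _, hi⟩ := Finset.exists_mem_eq_sup Finset.univ Finset.univ_nonempty
        fun i => ‖n i‖₊
      exact ⟨i, by rw [Pi.norm_def, hi]; rfl⟩
    have h2 := (H i).pow_mul_norm_fourierC_le hA n
    rw [h0, ← hi] at h2
    calc wt J n * ‖fourierC e₁ e₂ f n‖ ≤ (2 * ‖n‖) ^ J * ‖fourierC e₁ e₂ f n‖ := by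
          rw [wt]; gcongr; linarith
      _ = 2 ^ J * (‖n‖ ^ J * ‖fourierC e₁ e₂ f n‖) := by rw [mul_pow, mul_assoc]
      _ ≤ 2 ^ J * D := by gcongr

/-- Exponent 3 is the first integer above the dimension 2; it is the source of the three extra
derivatives. -/
theorem summable_inv_wt : Summable fun n : Fin 2 → ℤ => (wt 3 n)⁻¹ := by
  refine Summable.of_norm_bounded_eventually
    (EisensteinSeries.summable_one_div_norm_rpow (k := 3) (by norm_num)) ?_
  filter_upwards [(Set.finite_singleton (0 : Fin 2 → ℤ)).compl_mem_cofinite] with n hn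
  have hn0 : 0 < ‖n‖ := norm_pos_iff.2 hn
  rw [Real.norm_of_nonneg (inv_nonneg.2 (wt_pos _ _).le), Real.rpow_neg hn0.le, wt]
  have : ‖n‖ ^ (3 : ℝ) = ‖n‖ ^ 3 := by norm_cast
  rw [this]
  gcongr
  linarith

/-- The norm of a function in the Wiener algebra in terms of bounds for its derivatives. -/
def wienerConst (k : ℕ) : ℝ := 2 ^ (k + 3) * ∑' n : Fin 2 → ℤ, (wt 3 n)⁻¹

theorem wienerConst_nonneg (k : ℕ) : 0 ≤ wienerConst k :=
  mul_nonneg (by positivity) (tsum_nonneg fun n => inv_nonneg.2 (wt_pos 3 n).le)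

/-- The element `φ` is produced once and the norm bound holds for every admissible `D`. For the
Taylor coefficients of `F` the bound `D` depends on the Cauchy radius, and all radii are needed for
the same `φ`. -/
theorem exists_wiener (hA : cellArea e₁ e₂ ≠ 0) (k : ℕ) {f : ℂ → ℂ} {h : Fin 2 → ℕ → ℂ → ℂ}
    (h0 : ∀ i, h i 0 = f)
    (hex : ∃ D, (∀ x, ‖f x‖ ≤ D) ∧ ∀ i, HasPeriodDerivs e₁ e₂ i (k + 3) D (h i)) :
    ∃ φ : Wiener k, (∀ x, Wiener.evalHom e₁ e₂ x φ = f x) ∧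
      ∀ D, (∀ x, ‖f x‖ ≤ D) → (∀ i, HasPeriodDerivs e₁ e₂ i (k + 3) D (h i)) →
        ‖φ‖ ≤ wienerConst k * D := by
  have hle : ∀ D, (∀ x, ‖f x‖ ≤ D) → (∀ i, HasPeriodDerivs e₁ e₂ i (k + 3) D (h i)) → ∀ n,
      wt k n * ‖fourierC e₁ e₂ f n‖ ≤ 2 ^ (k + 3) * D * (wt 3 n)⁻¹ := fun D hD H n => by
    rw [← div_eq_mul_inv, le_div_iff₀ (wt_pos 3 n)]
    have h1 : wt (k + 3) n = wt k n * wt 3 n := by rw [wt, wt, wt, pow_add]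
    have := wt_mul_norm_fourierC_le hA hD h0 H n
    rw [h1] at this
    linarith
  obtain ⟨D, hD, H⟩ := hex
  have hf := ((H 0).deriv 0).periodic
  have hfc := ((H 0).deriv 0).continuous
  rw [h0] at hf hfc
  have hsum : Summable fun n => wt k n * ‖fourierC e₁ e₂ f n‖ :=
    .of_nonneg_of_le (fun n => mul_nonneg (wt_pos k n).le (norm_nonneg _)) (hle D hD H)
      (summable_inv_wt.mul_left _)
  refine ⟨Wiener.ofCoeff _ hsum, fun x => ?_, fun D hD H => ?_⟩
  · have h1 := Wiener.hasSum_evalHom e₁ e₂ x (Wiener.ofCoeff _ hsum)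
    have h2 : Summable (mFourierCoeff (⟨_, continuous_descend hA hf hfc⟩ :
        C(UnitAddTorus (Fin 2), ℂ))) :=
      .of_norm (.of_nonneg_of_le (fun _ => norm_nonneg _)
        (fun n => le_mul_of_one_le_left (norm_nonneg _) (one_le_wt k n)) hsum)
    have h3 := hasSum_mFourier_series_apply_of_summable h2 (toTorus e₁ e₂ x)
    rw [ContinuousMap.coe_mk, descend_toTorus hA hf] at h3
    refine h1.unique (h3.congr_fun fun n => ?_)
    rw [Wiener.coeff_ofCoeff, mFourier_toTorus]
    rfl
  · rw [Wiener.norm_ofCoeff]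
    refine (hsum.tsum_le_tsum (hle D hD H) (summable_inv_wt.mul_left _)).trans_eq ?_
    rw [tsum_mul_left, wienerConst]
    ring

/-! ### Parseval's identity and the `L²` comparison. -/

theorem integral_sq_descend (hA : cellArea e₁ e₂ ≠ 0) {f : ℂ → ℂ} (hf : LatticePeriodic e₁ e₂ f)
    (hc : Continuous f) :
    HasSum (fun n => ‖fourierC e₁ e₂ f n‖ ^ 2) (∫ θ, ‖descend e₁ e₂ f θ‖ ^ 2) := by
  let φ : C(UnitAddTorus (Fin 2), ℂ) := ⟨_, continuous_descend hA hf hc⟩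
  have h := hasSum_sq_mFourierCoeff (φ.toLp 2 volume ℂ)
  simp only [mFourierCoeff_toLp] at h
  have hint : ∫ θ, ‖descend e₁ e₂ f θ‖ ^ 2 = ∫ θ, ‖φ.toLp 2 volume ℂ θ‖ ^ 2 := by
    refine integral_congr_ae ?_
    filter_upwards [φ.coeFn_toLp (p := 2) (𝕜 := ℂ) volume] with θ hθ
    rw [hθ]
    rfl
  rw [hint]
  exact h

/-- Parseval gives `‖f‖ ≤ ‖g‖` in `L²` and the pointwise bound gives `‖g‖ ≤ ‖f‖ / 2`, so `f`
vanishes almost everywhere, hence everywhere by continuity. -/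
theorem eq_zero_of_fourierC_le (hA : cellArea e₁ e₂ ≠ 0) {f g : ℂ → ℂ}
    (hf : LatticePeriodic e₁ e₂ f) (hfc : Continuous f) (hg : LatticePeriodic e₁ e₂ g)
    (hgc : Continuous g) (hle : ∀ n, ‖fourierC e₁ e₂ f n‖ ≤ ‖fourierC e₁ e₂ g n‖)
    (hgf : ∀ x, ‖g x‖ ≤ 1 / 2 * ‖f x‖) (x : ℂ) : f x = 0 := by
  have hF := continuous_descend hA hf hfc
  have hG := continuous_descend hA hg hgc
  have hFi : Integrable fun θ => ‖descend e₁ e₂ f θ‖ ^ 2 :=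
    (hF.norm.pow 2).integrable_of_hasCompactSupport (HasCompactSupport.of_compactSpace _)
  have hGi : Integrable fun θ => ‖descend e₁ e₂ g θ‖ ^ 2 :=
    (hG.norm.pow 2).integrable_of_hasCompactSupport (HasCompactSupport.of_compactSpace _)
  have h1 : ∫ θ, ‖descend e₁ e₂ f θ‖ ^ 2 ≤ ∫ θ, ‖descend e₁ e₂ g θ‖ ^ 2 :=
    hasSum_le (fun n => by gcongr; exact hle n) (integral_sq_descend hA hf hfc)
      (integral_sq_descend hA hg hgc)
  have h2 : ∫ θ, ‖descend e₁ e₂ g θ‖ ^ 2 ≤ ∫ θ, 1 / 4 * ‖descend e₁ e₂ f θ‖ ^ 2 := by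
    refine integral_mono hGi (hFi.const_mul _) fun θ => ?_
    have := hgf (Function.invFun (toTorus e₁ e₂) θ)
    change ‖g _‖ ^ 2 ≤ 1 / 4 * ‖f _‖ ^ 2
    nlinarith [norm_nonneg (g (Function.invFun (toTorus e₁ e₂) θ))]
  rw [integral_const_mul] at h2
  have h3 : 0 ≤ ∫ θ, ‖descend e₁ e₂ f θ‖ ^ 2 := integral_nonneg fun _ => by positivity
  have h4 : ∫ θ, ‖descend e₁ e₂ f θ‖ ^ 2 = 0 := by linarith
  rw [integral_eq_zero_iff_of_nonneg (fun _ => by positivity) hFi] at h4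
  have h5 := (Continuous.ae_eq_iff_eq volume (by fun_prop) continuous_const).1 h4
  have h6 : ‖descend e₁ e₂ f (toTorus e₁ e₂ x)‖ ^ 2 = 0 := congrFun h5 (toTorus e₁ e₂ x)
  rwa [descend_toTorus hA hf, sq_eq_zero_iff, norm_eq_zero] at h6

end Torus

/-! ### Derivatives of Fourier series -/

/-- The linear form in the exponent of a character. -/
def charForm (e₁ e₂ : ℂ) (n : Fin 2 → ℤ) : ℂ →L[ℝ] ℂ :=
  (2 * Real.pi * Complex.I : ℂ) • Complex.ofRealCLM.comp (dualForm e₁ e₂ n)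

section Derivatives

variable {e₁ e₂ : ℂ}

theorem charForm_apply (n : Fin 2 → ℤ) (x : ℂ) :
    charForm e₁ e₂ n x = 2 * Real.pi * Complex.I * dualForm e₁ e₂ n x := rfl

theorem character_eq_exp (n : Fin 2 → ℤ) :
    character e₁ e₂ n = fun x => Complex.exp (charForm e₁ e₂ n x) := rfl

theorem contDiff_character (n : Fin 2 → ℤ) {N : WithTop ℕ∞} :
    ContDiff ℝ N (character e₁ e₂ n) := by
  rw [character_eq_exp]
  exact (charForm e₁ e₂ n).contDiff.cexp

theorem hasFDerivAt_character (n : Fin 2 → ℤ) (x : ℂ) :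
    HasFDerivAt (character e₁ e₂ n) (character e₁ e₂ n x • charForm e₁ e₂ n) x := by
  rw [character_eq_exp]
  exact (charForm e₁ e₂ n).hasFDerivAt.cexp

theorem norm_iteratedFDeriv_character_le (n : Fin 2 → ℤ) (j : ℕ) (x : ℂ) :
    ‖iteratedFDeriv ℝ j (character e₁ e₂ n) x‖ ≤ ‖charForm e₁ e₂ n‖ ^ j := by
  induction j with
  | zero => rw [norm_iteratedFDeriv_zero, norm_character, pow_zero]
  | succ j ih =>
    let T : ℂ →L[ℝ] ℂ →L[ℝ] ℂ :=
      (ContinuousLinearMap.lsmul ℝ ℂ).flip (charForm e₁ e₂ n)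
    have hT : ‖T‖ ≤ ‖charForm e₁ e₂ n‖ :=
      T.opNorm_le_bound (norm_nonneg _) fun c => by
        rw [mul_comm]; exact norm_smul_le c (charForm e₁ e₂ n)
    have h : fderiv ℝ (character e₁ e₂ n) = T ∘ character e₁ e₂ n :=
      funext fun x => (hasFDerivAt_character n x).fderiv
    rw [← norm_iteratedFDeriv_fderiv, h, pow_succ']
    refine (T.norm_iteratedFDeriv_comp_left (contDiff_character n (N := j)).contDiffAt
      le_rfl).trans ?_
    gcongr

variable {M : ℝ}

theorem IsLatticeBasis.cellArea_ne_zero (hL : IsLatticeBasis M e₁ e₂) (hM : 1 ≤ M) :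
    cellArea e₁ e₂ ≠ 0 := by
  have h : 0 < 1 / M := by positivity
  exact abs_pos.1 (h.trans_le hL.area)

theorem IsLatticeBasis.norm_div_area_le (hL : IsLatticeBasis M e₁ e₂) (hM : 1 ≤ M) {y : ℝ}
    (hy : |y| ≤ M) : ‖y / cellArea e₁ e₂‖ ≤ M ^ 2 := by
  have hM0 : 0 < M := by linarith
  have h : 1 / M ≤ |cellArea e₁ e₂| := hL.area
  have h0 : 0 < |cellArea e₁ e₂| := abs_pos.2 (hL.cellArea_ne_zero hM)
  rw [norm_div, Real.norm_eq_abs, Real.norm_eq_abs, div_le_iff₀ h0]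
  rw [div_le_iff₀ hM0] at h
  nlinarith

theorem IsLatticeBasis.norm_coord_le (hL : IsLatticeBasis M e₁ e₂) (hM : 1 ≤ M) (i : Fin 2) :
    ‖coord e₁ e₂ i‖ ≤ 2 * M ^ 2 := by
  have key : ∀ (a b : ℝ) (S T : ℂ →L[ℝ] ℝ), ‖S‖ = 1 → ‖T‖ = 1 → |a| ≤ M → |b| ≤ M →
      ‖(a / cellArea e₁ e₂) • S - (b / cellArea e₁ e₂) • T‖ ≤ 2 * M ^ 2 := by
    intro a b S T hS hT ha hb
    refine (norm_sub_le _ _).trans ?_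
    rw [norm_smul, norm_smul, hS, hT]
    linarith [hL.norm_div_area_le hM ha, hL.norm_div_area_le hM hb]
  have h1 := hL.norm_fst
  have h2 := hL.norm_snd
  fin_cases i
  · exact key e₂.im e₂.re _ _ Complex.reCLM_norm Complex.imCLM_norm ((Complex.abs_im_le_norm _).trans h2)
      ((Complex.abs_re_le_norm _).trans h2)
  · exact key e₁.re e₁.im _ _ Complex.imCLM_norm Complex.reCLM_norm ((Complex.abs_re_le_norm _).trans h1)
      ((Complex.abs_im_le_norm _).trans h1)

/-- A bound for the frequencies of the characters. -/
def freqBound (M : ℝ) : ℝ := 8 * Real.pi * M ^ 2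

theorem one_le_freqBound (hM : 1 ≤ M) : 1 ≤ freqBound M := by
  unfold freqBound
  nlinarith [Real.pi_gt_three, one_le_pow₀ hM (n := 2)]

theorem IsLatticeBasis.norm_charForm_le (hL : IsLatticeBasis M e₁ e₂) (hM : 1 ≤ M)
    (n : Fin 2 → ℤ) : ‖charForm e₁ e₂ n‖ ≤ freqBound M * ‖n‖ := by
  have hd : ‖dualForm e₁ e₂ n‖ ≤ 4 * M ^ 2 * ‖n‖ := by
    have key : ∀ i, ‖(n i : ℝ) • coord e₁ e₂ i‖ ≤ ‖n‖ * (2 * M ^ 2) := fun i => by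
      rw [norm_smul, Int.norm_cast_real]
      gcongr
      · exact norm_le_pi_norm n i
      · exact hL.norm_coord_le hM i
    refine (norm_add_le _ _).trans ?_
    linarith [key 0, key 1]
  have hc : ‖(2 * Real.pi * Complex.I : ℂ)‖ = 2 * Real.pi := by
    simp [abs_of_pos Real.pi_pos]
  have hcomp : ‖Complex.ofRealCLM.comp (dualForm e₁ e₂ n)‖ ≤ ‖dualForm e₁ e₂ n‖ := by
    refine (ContinuousLinearMap.opNorm_comp_le _ _).trans ?_
    rw [Complex.ofRealCLM_norm, one_mul]
  rw [charForm, norm_smul, hc, freqBound]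
  have := Real.pi_pos
  calc 2 * Real.pi * ‖Complex.ofRealCLM.comp (dualForm e₁ e₂ n)‖
      ≤ 2 * Real.pi * (4 * M ^ 2 * ‖n‖) := by gcongr; exact hcomp.trans hd
    _ = _ := by ring

variable {F : Type*} [NormedAddCommGroup F] [NormedSpace ℂ F] {k : ℕ}

theorem norm_iteratedFDeriv_term_le (hL : IsLatticeBasis M e₁ e₂) (hM : 1 ≤ M) (c : F)
    (n : Fin 2 → ℤ) {j : ℕ} (hj : j ≤ k) (x : ℂ) :
    ‖iteratedFDeriv ℝ j (fun x => character e₁ e₂ n x • c) x‖ ≤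
      freqBound M ^ k * (wt k n * ‖c‖) := by
  let T : ℂ →L[ℝ] F := (ContinuousLinearMap.lsmul ℝ ℂ).flip c
  have hT : ‖T‖ ≤ ‖c‖ := T.opNorm_le_bound (norm_nonneg _) fun a => by
    rw [mul_comm]; exact norm_smul_le a c
  have h1 := T.norm_iteratedFDeriv_comp_left
    (contDiff_character (e₁ := e₁) (e₂ := e₂) n (N := j)).contDiffAt (x := x) le_rfl
  have hΛ := one_le_freqBound hM
  have h2 : ‖charForm e₁ e₂ n‖ ^ j ≤ freqBound M ^ k * wt k n := by
    calc ‖charForm e₁ e₂ n‖ ^ j ≤ (freqBound M * (1 + ‖n‖)) ^ j := by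
          gcongr
          exact (hL.norm_charForm_le hM n).trans (by gcongr; linarith)
      _ ≤ (freqBound M * (1 + ‖n‖)) ^ k :=
          pow_le_pow_right₀ (by nlinarith [norm_nonneg n]) hj
      _ = _ := by rw [mul_pow, wt]
  calc _ ≤ ‖T‖ * ‖iteratedFDeriv ℝ j (character e₁ e₂ n) x‖ := h1
    _ ≤ ‖c‖ * (freqBound M ^ k * wt k n) := by
        gcongr; exact (norm_iteratedFDeriv_character_le n j x).trans h2
    _ = _ := by ring

variable {c : (Fin 2 → ℤ) → F}

theorem contDiff_term (n : Fin 2 → ℤ) {N : WithTop ℕ∞} :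
    ContDiff ℝ N fun x => character e₁ e₂ n x • c n :=
  (contDiff_character n).smul contDiff_const

variable [CompleteSpace F]

theorem contDiff_series (hL : IsLatticeBasis M e₁ e₂) (hM : 1 ≤ M)
    (hc : Summable fun n => wt k n * ‖c n‖) :
    ContDiff ℝ ((k : ℕ∞) : WithTop ℕ∞) fun x => ∑' n, character e₁ e₂ n x • c n :=
  contDiff_tsum (fun n => contDiff_term n) (fun _ _ => hc.mul_left _) fun _ n x hj =>
    norm_iteratedFDeriv_term_le hL hM (c n) n (by exact_mod_cast hj) x

theorem norm_iteratedFDeriv_series_le (hL : IsLatticeBasis M e₁ e₂) (hM : 1 ≤ M)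
    (hc : Summable fun n => wt k n * ‖c n‖) {j : ℕ} (hj : j ≤ k) (x : ℂ) :
    ‖iteratedFDeriv ℝ j (fun x => ∑' n, character e₁ e₂ n x • c n) x‖ ≤
      freqBound M ^ k * ∑' n, wt k n * ‖c n‖ := by
  rw [iteratedFDeriv_tsum_apply (N := k) (v := fun _ n => freqBound M ^ k * (wt k n * ‖c n‖))
    (fun n => contDiff_term n) (fun _ _ => hc.mul_left _) (fun _ n x hj =>
    norm_iteratedFDeriv_term_le hL hM (c n) n (by exact_mod_cast hj) x) (by exact_mod_cast hj)]
  exact tsum_of_norm_bounded (hc.hasSum.mul_left _) fun n =>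
    norm_iteratedFDeriv_term_le hL hM (c n) n hj x

end Derivatives

/-! ### The Hölder norm -/

/-- One derivative beyond `⌊m⌋` controls the Hölder seminorm: the Lipschitz bound serves points at
distance at most 1, the bound `2B` on differences serves the others. The count `⌊m⌋ + 3` is `⌊m⌋ +
1` sup norms plus 2 for the seminorm. -/
theorem holderNorm_le {m : ℝ} (hm : 0 < m) {v : ℂ → ℂ × ℂ} {B : ℝ}
    (hv : ContDiff ℝ ((⌊m⌋₊ + 1 : ℕ) : ℕ∞) v)
    (hB : ∀ j ≤ ⌊m⌋₊ + 1, ∀ x, ‖iteratedFDeriv ℝ j v x‖ ≤ B) :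
    holderNorm m v ≤ ENNReal.ofReal ((⌊m⌋₊ + 3) * B) := by
  have hB0 : 0 ≤ B := (norm_nonneg _).trans (hB 0 (Nat.zero_le _) 0)
  have h1 : ∑ j ∈ Finset.range (⌊m⌋₊ + 1), ⨆ x : ℂ, ‖iteratedFDeriv ℝ j v x‖ₑ ≤
      ENNReal.ofReal ((⌊m⌋₊ + 1) * B) := by
    calc _ ≤ ∑ _j ∈ Finset.range (⌊m⌋₊ + 1), ENNReal.ofReal B := by
          refine Finset.sum_le_sum fun j hj => iSup_le fun x => ?_
          rw [← ofReal_norm]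
          exact ENNReal.ofReal_le_ofReal (hB j (Finset.mem_range.1 hj).le x)
      _ = _ := by
          rw [Finset.sum_const, Finset.card_range, nsmul_eq_mul,
            ENNReal.ofReal_mul (by positivity), ← Nat.cast_add_one, ENNReal.ofReal_natCast]
  set g := iteratedFDeriv ℝ ⌊m⌋₊ v with hg
  have hfl : (⌊m⌋₊ : ℝ) ≤ m := Nat.floor_le hm.le
  have hfl' := Nat.lt_floor_add_one m
  have hθ : ((m - ⌊m⌋₊).toNNReal : ℝ) = m - ⌊m⌋₊ :=
    Real.coe_toNNReal _ (by linarith)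
  have hdiff : Differentiable ℝ g := hv.differentiable_iteratedFDeriv (by
    exact_mod_cast Nat.lt_succ_self _)
  have hlip : ∀ x y, ‖g x - g y‖ ≤ B * ‖x - y‖ := fun x y =>
    convex_univ.norm_image_sub_le_of_norm_fderiv_le (𝕜 := ℝ) (fun z _ => hdiff z)
      (fun z _ => by
        rw [hg, fderiv_iteratedFDeriv, Function.comp_apply, LinearIsometryEquiv.norm_map]
        exact hB _ le_rfl z) (Set.mem_univ y) (Set.mem_univ x)
  have hbd : ∀ x y, ‖g x - g y‖ ≤ 2 * B := fun x y =>
    (norm_sub_le _ _).trans (by linarith [hB _ (Nat.le_succ ⌊m⌋₊) x, hB _ (Nat.le_succ ⌊m⌋₊) y])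
  have h2 : eHolderNorm (m - ⌊m⌋₊).toNNReal g ≤ ENNReal.ofReal (2 * B) := by
    refine HolderWith.eHolderNorm_le (C := (2 * B).toNNReal) fun x y => ?_
    rw [hθ, edist_dist, edist_dist, ENNReal.ofReal_rpow_of_nonneg dist_nonneg (by linarith)]
    change _ ≤ ENNReal.ofReal (2 * B) * _
    rw [← ENNReal.ofReal_mul (by positivity), dist_eq_norm, dist_eq_norm]
    refine ENNReal.ofReal_le_ofReal ?_
    rcases le_total ‖x - y‖ 1 with h | h
    · have h3 : ‖x - y‖ ≤ ‖x - y‖ ^ (m - ⌊m⌋₊) := by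
        conv_lhs => rw [← Real.rpow_one ‖x - y‖]
        rcases (norm_nonneg (x - y)).eq_or_lt with h0 | h0
        · rw [← h0, Real.zero_rpow one_ne_zero]
          exact Real.rpow_nonneg le_rfl _
        · exact Real.rpow_le_rpow_of_exponent_ge h0 h (by linarith)
      calc _ ≤ B * ‖x - y‖ := hlip x y
        _ ≤ (2 * B) * ‖x - y‖ ^ (m - ⌊m⌋₊) := by gcongr; linarith
    · calc _ ≤ 2 * B * 1 := by rw [mul_one]; exact hbd x y
        _ ≤ _ := by gcongr; exact Real.one_le_rpow h (by linarith)
  calc holderNorm m v ≤ ENNReal.ofReal ((⌊m⌋₊ + 1) * B) + ENNReal.ofReal (2 * B) :=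
        add_le_add h1 h2
    _ = _ := by
        rw [← ENNReal.ofReal_add (by positivity) (by positivity)]
        congr 1
        ring

/-! ### Symbols of the Cauchy-Riemann operators -/

/-- The symbol of `∂/∂x̄`. -/
def dbarSymbol (e₁ e₂ : ℂ) (n : Fin 2 → ℤ) : ℂ :=
  (1 / 2) * (charForm e₁ e₂ n 1 + Complex.I * charForm e₁ e₂ n Complex.I)

/-- The symbol of `∂/∂x`. -/
def delSymbol (e₁ e₂ : ℂ) (n : Fin 2 → ℤ) : ℂ :=
  (1 / 2) * (charForm e₁ e₂ n 1 - Complex.I * charForm e₁ e₂ n Complex.I)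

section Symbols

variable {e₁ e₂ : ℂ} {M : ℝ}

theorem charForm_one (n : Fin 2 → ℤ) :
    charForm e₁ e₂ n 1 = dbarSymbol e₁ e₂ n + delSymbol e₁ e₂ n := by
  rw [dbarSymbol, delSymbol]; ring

theorem charForm_I (n : Fin 2 → ℤ) :
    charForm e₁ e₂ n Complex.I = Complex.I * (delSymbol e₁ e₂ n - dbarSymbol e₁ e₂ n) := by
  rw [dbarSymbol, delSymbol]
  linear_combination (charForm e₁ e₂ n Complex.I) * Complex.I_mul_I

/-- For real `a`, `b` the two numbers are complex conjugates. This is why `∂/∂x` and `∂/∂x̄` have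
symbols of equal modulus. -/
theorem norm_symbol_aux (a b : ℝ) : ‖(a + Complex.I * b : ℂ)‖ = ‖(a - Complex.I * b : ℂ)‖ := by
  rw [← Complex.norm_conj]
  congr 1
  simp
  ring

theorem dbarSymbol_eq (n : Fin 2 → ℤ) : dbarSymbol e₁ e₂ n = Real.pi * Complex.I *
    (dualForm e₁ e₂ n 1 + Complex.I * dualForm e₁ e₂ n Complex.I) := by
  rw [dbarSymbol, charForm_apply, charForm_apply]; ring

theorem delSymbol_eq (n : Fin 2 → ℤ) : delSymbol e₁ e₂ n = Real.pi * Complex.I *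
    (dualForm e₁ e₂ n 1 - Complex.I * dualForm e₁ e₂ n Complex.I) := by
  rw [delSymbol, charForm_apply, charForm_apply]; ring

theorem norm_delSymbol (n : Fin 2 → ℤ) : ‖delSymbol e₁ e₂ n‖ = ‖dbarSymbol e₁ e₂ n‖ := by
  rw [delSymbol_eq, dbarSymbol_eq, norm_mul _ (_ - _), norm_mul _ (_ + _), norm_symbol_aux]

theorem dbarSymbol_zero : dbarSymbol e₁ e₂ 0 = 0 := by simp [dbarSymbol_eq, dualForm]

/-- Ellipticity, uniform in the lattice. The value of the dual form at the period `eᵢ` is `nᵢ`, so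
`|nᵢ| ≤ 2M |p + iq|`, while the symbol has modulus `π |p + iq|`. -/
theorem IsLatticeBasis.norm_le_mul_dbarSymbol (hL : IsLatticeBasis M e₁ e₂) (hM : 1 ≤ M)
    (n : Fin 2 → ℤ) : ‖n‖ ≤ M * ‖dbarSymbol e₁ e₂ n‖ := by
  have hA := hL.cellArea_ne_zero hM
  set p := dualForm e₁ e₂ n 1 with hp
  set q := dualForm e₁ e₂ n Complex.I with hq
  have hre : |p| ≤ ‖(p + Complex.I * q : ℂ)‖ := by
    simpa using Complex.abs_re_le_norm (p + Complex.I * q)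
  have him : |q| ≤ ‖(p + Complex.I * q : ℂ)‖ := by
    simpa using Complex.abs_im_le_norm (p + Complex.I * q)
  have hν : ‖dbarSymbol e₁ e₂ n‖ = Real.pi * ‖(p + Complex.I * q : ℂ)‖ := by
    rw [dbarSymbol_eq, norm_mul, norm_mul, Complex.norm_I, Complex.norm_real,
      Real.norm_of_nonneg Real.pi_pos.le, mul_one]
  refine (pi_norm_le_iff_of_nonneg (by positivity)).2 fun i => ?_
  have hei : ‖![e₁, e₂] i‖ ≤ M := by
    fin_cases i
    · exact hL.norm_fst
    · exact hL.norm_snd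
  have hni : (n i : ℝ) = (![e₁, e₂] i).re * p + (![e₁, e₂] i).im * q := by
    have h1 : dualForm e₁ e₂ n (![e₁, e₂] i) = n i := by
      simp only [dualForm, add_apply, smul_apply, coord_basis hA, smul_eq_mul]
      fin_cases i <;> simp
    rw [← h1]
    conv_lhs => rw [← Complex.re_add_im (![e₁, e₂] i)]
    have h2 : (((![e₁, e₂] i).re : ℂ) + (![e₁, e₂] i).im * Complex.I) =
        (![e₁, e₂] i).re • (1 : ℂ) + (![e₁, e₂] i).im • Complex.I := by simp
    rw [h2, map_add, map_smul, map_smul, smul_eq_mul, smul_eq_mul]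
  rw [Int.norm_eq_abs, hni, hν]
  refine (abs_add_le _ _).trans ?_
  rw [abs_mul, abs_mul]
  have h1 := (Complex.abs_re_le_norm _).trans hei
  have h2 := (Complex.abs_im_le_norm _).trans hei
  have h3 := mul_le_mul h1 hre (abs_nonneg p) (by linarith)
  have h4 := mul_le_mul h2 him (abs_nonneg q) (by linarith)
  have h5 : 0 ≤ M * ‖(p + Complex.I * q : ℂ)‖ := by positivity
  nlinarith [Real.pi_gt_three]

theorem IsLatticeBasis.dbarSymbol_ne_zero (hL : IsLatticeBasis M e₁ e₂) (hM : 1 ≤ M)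
    {n : Fin 2 → ℤ} (hn : n ≠ 0) : dbarSymbol e₁ e₂ n ≠ 0 := fun h => by
  have := hL.norm_le_mul_dbarSymbol hM n
  rw [h, norm_zero, mul_zero] at this
  exact hn (norm_le_zero_iff.1 this)

theorem one_le_norm_of_ne_zero {n : Fin 2 → ℤ} (hn : n ≠ 0) : 1 ≤ ‖n‖ := by
  obtain ⟨i, hi⟩ := Function.ne_iff.1 hn
  refine le_trans ?_ (norm_le_pi_norm n i)
  rw [Int.norm_eq_abs]
  exact_mod_cast Int.one_le_abs hi

theorem IsLatticeBasis.norm_inv_mul_dbarSymbol_le (hL : IsLatticeBasis M e₁ e₂) (hM : 1 ≤ M)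
    (n : Fin 2 → ℤ) : ‖((M : ℂ) * dbarSymbol e₁ e₂ n)⁻¹‖ ≤ 1 := by
  rcases eq_or_ne n 0 with rfl | hn
  · simp [dbarSymbol_zero]
  · rw [norm_inv, norm_mul, Complex.norm_real, Real.norm_of_nonneg (by linarith)]
    exact inv_le_one_of_one_le₀
      ((one_le_norm_of_ne_zero hn).trans (hL.norm_le_mul_dbarSymbol hM n))

/-- The symbol of the Beurling transform `(∂/∂x) (∂/∂x̄)⁻¹`. -/
def beurlingSymbol (e₁ e₂ : ℂ) (n : Fin 2 → ℤ) : ℂ := delSymbol e₁ e₂ n / dbarSymbol e₁ e₂ n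

theorem norm_beurlingSymbol_le (n : Fin 2 → ℤ) : ‖beurlingSymbol e₁ e₂ n‖ ≤ 1 := by
  rw [beurlingSymbol, norm_div, norm_delSymbol]
  exact div_self_le_one _

end Symbols

/-! ### The Cauchy-Riemann equation with data in the Wiener algebra -/

/-- The Beurling transform `(∂/∂x) (∂/∂x̄)⁻¹` on the Wiener algebra. -/
def beurling {k : ℕ} (e₁ e₂ : ℂ) (f : Wiener k) : Wiener k :=
  Wiener.multiplier (beurlingSymbol e₁ e₂) norm_beurlingSymbol_le f

/-- The periodic solution of `∂u/∂x̄ = f - f₀`, where `f₀` is the mean of `f`. -/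
def primitive {k : ℕ} (e₁ e₂ : ℂ) (f : Wiener k) (x : ℂ) : ℂ :=
  ∑' n, character e₁ e₂ n x • (Wiener.coeff f n / dbarSymbol e₁ e₂ n)

/-- The Fourier coefficients of the gradient of `primitive`. -/
def gradCoeff {k : ℕ} (e₁ e₂ : ℂ) (f : Wiener k) (n : Fin 2 → ℤ) : ℂ × ℂ :=
  (Wiener.coeff f n / dbarSymbol e₁ e₂ n * charForm e₁ e₂ n 1,
    Wiener.coeff f n / dbarSymbol e₁ e₂ n * charForm e₁ e₂ n Complex.I)

theorem Wiener.coeff_one {k : ℕ} (n : Fin 2 → ℤ) :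
    coeff (1 : Wiener k) n = if n = 0 then 1 else 0 := by
  change (Pi.single 0 1 : (Fin 2 → ℤ) → ℂ) n / (wt k n : ℂ) = _
  rw [Pi.single_apply]
  split_ifs with h
  · rw [h, wt_zero]; simp
  · simp

section Linear

variable {e₁ e₂ : ℂ} {M : ℝ} {k : ℕ}

theorem norm_beurling_le (f : Wiener k) : ‖beurling e₁ e₂ f‖ ≤ ‖f‖ :=
  Wiener.norm_multiplier_le _ _ f

theorem beurling_sub (f g : Wiener k) :
    beurling e₁ e₂ (f - g) = beurling e₁ e₂ f - beurling e₁ e₂ g :=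
  Wiener.multiplier_sub _ _ f g

theorem IsLatticeBasis.summable_primitive (hL : IsLatticeBasis M e₁ e₂) (hM : 1 ≤ M)
    (f : Wiener k) :
    Summable fun n => wt k n * ‖Wiener.coeff f n / dbarSymbol e₁ e₂ n‖ := by
  refine .of_nonneg_of_le (fun n => mul_nonneg (wt_pos k n).le (norm_nonneg _)) (fun n => ?_)
    ((Wiener.hasSum_norm_coeff f).summable.mul_left M)
  have h := hL.norm_inv_mul_dbarSymbol_le hM n
  have hM0 : 0 < M := by linarith
  rw [norm_inv, norm_mul, Complex.norm_real, Real.norm_of_nonneg hM0.le, mul_inv,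
    inv_mul_le_iff₀ hM0, mul_one] at h
  rw [norm_div, div_eq_mul_inv]
  have := mul_le_mul_of_nonneg_left h
    (mul_nonneg (wt_pos k n).le (norm_nonneg (Wiener.coeff f n)))
  linarith

theorem primitive_periodic (hA : cellArea e₁ e₂ ≠ 0) (f : Wiener k) :
    LatticePeriodic e₁ e₂ (primitive e₁ e₂ f) := by
  constructor <;> intro x <;> refine tsum_congr fun n => ?_
  · rw [(character_periodic hA n).1 x]
  · rw [(character_periodic hA n).2 x]

theorem contDiff_primitive (hL : IsLatticeBasis M e₁ e₂) (hM : 1 ≤ M) (f : Wiener k) :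
    ContDiff ℝ ((k : ℕ∞) : WithTop ℕ∞) (primitive e₁ e₂ f) :=
  contDiff_series hL hM (hL.summable_primitive hM f)

/-- At `n = 0` both quotients by the vanishing symbol are 0 by convention, so the left side and the
Beurling term vanish, and subtracting the mean cancels the coefficient of `f`. -/
theorem gradCoeff_fst (hL : IsLatticeBasis M e₁ e₂) (hM : 1 ≤ M) (f : Wiener k)
    (n : Fin 2 → ℤ) : (gradCoeff e₁ e₂ f n).1 =
      Wiener.coeff (f + beurling e₁ e₂ f - Wiener.coeff f 0 • (1 : Wiener k)) n := by
  rw [Wiener.coeff_sub, Wiener.coeff_add, Wiener.coeff_smul, Wiener.coeff_one, beurling,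
    Wiener.coeff_multiplier, beurlingSymbol, gradCoeff, charForm_one]
  rcases eq_or_ne n 0 with rfl | hn
  · simp [dbarSymbol_zero]
  · have := hL.dbarSymbol_ne_zero hM hn
    simp only [hn, if_false]
    field_simp
    ring

theorem gradCoeff_snd (hL : IsLatticeBasis M e₁ e₂) (hM : 1 ≤ M) (f : Wiener k)
    (n : Fin 2 → ℤ) : (gradCoeff e₁ e₂ f n).2 = Wiener.coeff
      (Complex.I • (beurling e₁ e₂ f - f + Wiener.coeff f 0 • (1 : Wiener k))) n := by
  rw [Wiener.coeff_smul, Wiener.coeff_add, Wiener.coeff_sub, Wiener.coeff_smul, Wiener.coeff_one,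
    beurling, Wiener.coeff_multiplier, beurlingSymbol, gradCoeff, charForm_I]
  rcases eq_or_ne n 0 with rfl | hn
  · simp [dbarSymbol_zero]
  · have := hL.dbarSymbol_ne_zero hM hn
    simp only [hn, if_false]
    field_simp
    ring

theorem norm_gradCoeff_le (f : Wiener k) (n : Fin 2 → ℤ) :
    ‖gradCoeff e₁ e₂ f n‖ ≤ 2 * ‖Wiener.coeff f n‖ := by
  have key : ∀ z : ℂ, ‖z‖ ≤ 2 * ‖dbarSymbol e₁ e₂ n‖ →
      ‖Wiener.coeff f n / dbarSymbol e₁ e₂ n * z‖ ≤ 2 * ‖Wiener.coeff f n‖ := fun z hz => by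
    rw [norm_mul, norm_div]
    calc _ ≤ ‖Wiener.coeff f n‖ / ‖dbarSymbol e₁ e₂ n‖ * (2 * ‖dbarSymbol e₁ e₂ n‖) := by gcongr
      _ = 2 * ‖Wiener.coeff f n‖ * (‖dbarSymbol e₁ e₂ n‖ / ‖dbarSymbol e₁ e₂ n‖) := by ring
      _ ≤ 2 * ‖Wiener.coeff f n‖ * 1 := by gcongr; exact div_self_le_one _
      _ = _ := mul_one _
  refine max_le (key _ ?_) (key _ ?_)
  · rw [charForm_one]
    refine (norm_add_le _ _).trans_eq ?_
    rw [norm_delSymbol]; ring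
  · rw [charForm_I, norm_mul, Complex.norm_I, one_mul]
    refine (norm_sub_le _ _).trans_eq ?_
    rw [norm_delSymbol]; ring

theorem summable_gradCoeff (f : Wiener k) :
    Summable fun n => wt k n * ‖gradCoeff e₁ e₂ f n‖ :=
  .of_nonneg_of_le (fun n => mul_nonneg (wt_pos k n).le (norm_nonneg _))
    (fun n => (mul_le_mul_of_nonneg_left (norm_gradCoeff_le f n) (wt_pos k n).le).trans_eq
      (by ring : _ = 2 * (wt k n * ‖Wiener.coeff f n‖)))
    ((Wiener.hasSum_norm_coeff f).summable.mul_left 2)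

theorem tsum_gradCoeff_le (f : Wiener k) :
    ∑' n, wt k n * ‖gradCoeff e₁ e₂ f n‖ ≤ 2 * ‖f‖ :=
  hasSum_le (fun n => (mul_le_mul_of_nonneg_left (norm_gradCoeff_le f n) (wt_pos k n).le).trans_eq
      (by ring : _ = 2 * (wt k n * ‖Wiener.coeff f n‖)))
    (summable_gradCoeff f).hasSum ((Wiener.hasSum_norm_coeff f).mul_left 2)

/-- The spare power of the weight pays for the factor `charForm` that appears in termwise
differentiation. -/
theorem hasSum_fderiv_primitive (hL : IsLatticeBasis M e₁ e₂) (hM : 1 ≤ M) (f : Wiener (k + 1))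
    (x v : ℂ) :
    HasSum (fun n => character e₁ e₂ n x *
      (Wiener.coeff f n / dbarSymbol e₁ e₂ n * charForm e₁ e₂ n v))
      (fderiv ℝ (primitive e₁ e₂ f) x v) := by
  set c := fun n => Wiener.coeff f n / dbarSymbol e₁ e₂ n with hcdef
  set f' := fun (n : Fin 2 → ℤ) (x : ℂ) => c n • (character e₁ e₂ n x • charForm e₁ e₂ n) with hf'
  have hc := hL.summable_primitive hM f
  have hu := hc.mul_left (freqBound M)
  have hd : ∀ n x, HasFDerivAt (fun x => character e₁ e₂ n x • c n) (f' n x) x := fun n x => by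
    simpa only [smul_eq_mul] using (hasFDerivAt_character n x).mul_const (c n)
  have hb : ∀ n x, ‖f' n x‖ ≤ freqBound M * (wt (k + 1) n * ‖c n‖) := fun n x => by
    rw [hf', norm_smul, norm_smul, norm_character, one_mul]
    have h1 := hL.norm_charForm_le hM n
    have h2 : ‖n‖ ≤ wt (k + 1) n := by
      rw [wt, pow_succ]
      have := one_le_wt k n
      rw [wt] at this
      nlinarith [norm_nonneg n]
    have := one_le_freqBound hM
    calc ‖c n‖ * ‖charForm e₁ e₂ n‖ ≤ ‖c n‖ * (freqBound M * wt (k + 1) n) := by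
          gcongr; exact h1.trans (by gcongr)
      _ = _ := by ring
  have h0 : Summable fun n => character e₁ e₂ n 0 • c n := .of_norm_bounded hc fun n => by
    rw [norm_smul, norm_character, one_mul]
    exact le_mul_of_one_le_left (norm_nonneg _) (one_le_wt _ n)
  have h1 : HasFDerivAt (primitive e₁ e₂ f) (∑' n, f' n x) x :=
    hasFDerivAt_tsum hu hd hb h0 x
  have h2 : Summable fun n => f' n x := .of_norm_bounded hu fun n => hb n x
  rw [h1.fderiv]
  have h3 := (ContinuousLinearMap.apply ℝ ℂ v).hasSum h2.hasSum
  refine h3.congr_fun fun n => ?_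
  simp only [hf', ContinuousLinearMap.apply_apply, smul_apply, smul_eq_mul]
  ring

theorem grad_primitive_eq_series (hL : IsLatticeBasis M e₁ e₂) (hM : 1 ≤ M)
    (f : Wiener (k + 1)) :
    grad (primitive e₁ e₂ f) = fun x => ∑' n, character e₁ e₂ n x • gradCoeff e₁ e₂ f n :=
  funext fun x => (((hasSum_fderiv_primitive hL hM f x 1).prodMk
    (hasSum_fderiv_primitive hL hM f x Complex.I)).tsum_eq).symm

theorem grad_primitive (hL : IsLatticeBasis M e₁ e₂) (hM : 1 ≤ M) (f : Wiener (k + 1)) (x : ℂ) :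
    grad (primitive e₁ e₂ f) x =
      (Wiener.evalHom e₁ e₂ x f + Wiener.evalHom e₁ e₂ x (beurling e₁ e₂ f) - Wiener.coeff f 0,
      Complex.I * (Wiener.evalHom e₁ e₂ x (beurling e₁ e₂ f) - Wiener.evalHom e₁ e₂ x f +
        Wiener.coeff f 0)) := by
  refine Prod.ext ?_ ?_
  · have h1 := hasSum_fderiv_primitive hL hM f x 1
    have h2 := Wiener.hasSum_evalHom e₁ e₂ x
      (f + beurling e₁ e₂ f - Wiener.coeff f 0 • (1 : Wiener (k + 1)))
    rw [map_sub, map_add, map_smul, map_one, smul_eq_mul, mul_one] at h2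
    refine h1.unique (h2.congr_fun fun n => ?_)
    rw [← gradCoeff_fst hL hM, gradCoeff, mul_comm]
  · have h1 := hasSum_fderiv_primitive hL hM f x Complex.I
    have h2 := Wiener.hasSum_evalHom e₁ e₂ x
      (Complex.I • (beurling e₁ e₂ f - f + Wiener.coeff f 0 • (1 : Wiener (k + 1))))
    rw [map_smul, map_add, map_sub, map_smul, map_one, smul_eq_mul, smul_eq_mul, mul_one] at h2
    refine h1.unique (h2.congr_fun fun n => ?_)
    rw [← gradCoeff_snd hL hM, gradCoeff, mul_comm]

theorem norm_coeff_le (f : Wiener k) (n : Fin 2 → ℤ) : ‖Wiener.coeff f n‖ ≤ ‖f‖ :=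
  (le_mul_of_one_le_left (norm_nonneg _) (one_le_wt k n)).trans
    (le_hasSum (Wiener.hasSum_norm_coeff f) n fun n _ =>
      mul_nonneg (wt_pos k n).le (norm_nonneg _))

/-- The norm of the map from the Wiener algebra to `C^m` solutions. -/
def sizeConst (m M : ℝ) : ℝ := 1 + (⌊m⌋₊ + 3) * (freqBound M ^ (⌊m⌋₊ + 1) * 2)

/-- The map from `f` to the gradient has order zero, so weight `⌊m⌋ + 1` on `f` yields `⌊m⌋ + 1`
bounded derivatives of the gradient, which is what `holderNorm_le` requires. -/
theorem size_primitive_le (hL : IsLatticeBasis M e₁ e₂) (hM : 1 ≤ M) {m : ℝ} (hm : 0 < m)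
    (f : Wiener (⌊m⌋₊ + 1)) :
    size m (primitive e₁ e₂ f) (Wiener.coeff f 0) ≤ ENNReal.ofReal (sizeConst m M * ‖f‖) := by
  have hΛ := one_le_freqBound hM
  have h1 : holderNorm m (grad (primitive e₁ e₂ f)) ≤
      ENNReal.ofReal ((⌊m⌋₊ + 3) * (freqBound M ^ (⌊m⌋₊ + 1) * (2 * ‖f‖))) := by
    rw [grad_primitive_eq_series hL hM f]
    refine holderNorm_le hm (contDiff_series hL hM (summable_gradCoeff f)) fun j hj x => ?_
    refine (norm_iteratedFDeriv_series_le hL hM (summable_gradCoeff f) hj x).trans ?_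
    gcongr
    exact tsum_gradCoeff_le f
  have h2 : ‖Wiener.coeff f 0‖ₑ ≤ ENNReal.ofReal ‖f‖ := by
    rw [← ofReal_norm]
    exact ENNReal.ofReal_le_ofReal (norm_coeff_le f 0)
  calc _ ≤ ENNReal.ofReal ‖f‖ +
        ENNReal.ofReal ((⌊m⌋₊ + 3) * (freqBound M ^ (⌊m⌋₊ + 1) * (2 * ‖f‖))) :=
        add_le_add h2 h1
    _ = _ := by
        rw [← ENNReal.ofReal_add (norm_nonneg _) (by positivity), sizeConst]
        congr 1
        ring

/-! ### Differentiation of grad-periodic functions -/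

theorem hasFDerivAt_gradPeriodic {u : ℂ → ℂ} (hu : Differentiable ℝ u) (b x : ℂ) :
    HasFDerivAt (gradPeriodic u b)
      (fderiv ℝ u x + b • (Complex.conjCLE : ℂ →L[ℝ] ℂ)) x :=
  (hu x).hasFDerivAt.add ((Complex.conjCLE : ℂ →L[ℝ] ℂ).hasFDerivAt.const_mul b)

theorem grad_gradPeriodic {u : ℂ → ℂ} (hu : Differentiable ℝ u) (b x : ℂ) :
    grad (gradPeriodic u b) x = ((grad u x).1 + b, (grad u x).2 - b * Complex.I) := by
  rw [grad, (hasFDerivAt_gradPeriodic hu b x).fderiv, grad]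
  simp [sub_eq_add_neg]

end Linear

/-! ### Smooth data in the Wiener algebra -/

section Data

variable {e₁ e₂ : ℂ} {M : ℝ}

theorem IsLatticeBasis.norm_period_le (hL : IsLatticeBasis M e₁ e₂) (i : Fin 2) :
    ‖![e₁, e₂] i‖ ≤ M := by
  fin_cases i
  · exact hL.norm_fst
  · exact hL.norm_snd

/-- The norm in the Wiener algebra of data whose derivatives of order `j` are bounded by `N j`. -/
def dataConst (k : ℕ) (M : ℝ) (N : ℕ → ℝ) : ℝ :=
  wienerConst k * (|N 0| + |N (k + 3)| * M ^ (k + 3))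

theorem dataConst_nonneg (k : ℕ) (hM : 1 ≤ M) (N : ℕ → ℝ) : 0 ≤ dataConst k M N :=
  mul_nonneg (wienerConst_nonneg k) (by positivity)

theorem hasDerivAt_iteratedFDeriv_line {f : ℂ → ℂ} (hf : ContDiff ℝ ∞ f) (e : ℂ) (j : ℕ) (x : ℂ) :
    HasDerivAt (fun s : ℝ => iteratedFDeriv ℝ j f (x + s * e) fun _ => e)
      (iteratedFDeriv ℝ (j + 1) f x fun _ => e) 0 := by
  have hd : DifferentiableAt ℝ (iteratedFDeriv ℝ j f) (x + (0 : ℝ) * e) :=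
    (hf.differentiable_iteratedFDeriv (by exact_mod_cast WithTop.coe_lt_top _)) _
  have hline : HasDerivAt (fun s : ℝ => x + s * e) e 0 := by
    have := ((hasDerivAt_id (0 : ℝ)).ofReal_comp.mul_const e).const_add x
    simpa using this
  have h1 := hd.hasFDerivAt.comp_hasDerivAt (0 : ℝ) hline
  have h2 := ((ContinuousMultilinearMap.apply ℝ (fun _ : Fin j => ℂ) ℂ
    fun _ => e).hasFDerivAt).comp_hasDerivAt (0 : ℝ) h1
  refine h2.congr_deriv ?_
  rw [iteratedFDeriv_succ_apply_left]
  simp only [Complex.ofReal_zero, zero_mul, add_zero]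
  rfl

theorem IsSmoothBigO.exists_wiener {N : ℕ → ℝ} {ε : ℝ} {f : ℂ → ℂ}
    (hL : IsLatticeBasis M e₁ e₂) (hM : 1 ≤ M) (hε : 0 < ε) (hf : IsSmoothBigO N ε e₁ e₂ f)
    (k : ℕ) :
    ∃ φ : Wiener k, (∀ x, Wiener.evalHom e₁ e₂ x φ = f x) ∧ ‖φ‖ ≤ dataConst k M N * ε := by
  -- Successive derivatives along a period are the iterated derivative evaluated on copies of that
  -- period; evaluation at order `k + 3` costs the factor `M^(k+3)`.
  set h : Fin 2 → ℕ → ℂ → ℂ := fun i j x => iteratedFDeriv ℝ j f x fun _ => ![e₁, e₂] i with hh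
  have hper : ∀ i j, LatticePeriodic e₁ e₂ (h i j) := fun i j => by
    have key : ∀ e, Function.Periodic f e → Function.Periodic (h i j) e := fun e he x => by
      have h1 : (fun z => f (z + e)) = f := funext he
      rw [hh]
      simp only
      rw [← iteratedFDeriv_comp_add_right, h1]
    exact ⟨key _ hf.periodic.1, key _ hf.periodic.2⟩
  have hcont : ∀ i j, Continuous (h i j) := fun i j =>
    (ContinuousMultilinearMap.apply ℝ (fun _ : Fin j => ℂ) ℂ _).continuous.comp
      (hf.smooth.continuous_iteratedFDeriv (by exact_mod_cast le_top))
  have h0 : ∀ i, h i 0 = f := fun i => funext fun x => by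
    rw [hh]; simp only; rw [iteratedFDeriv_zero_apply]
  have hb0 : ∀ x, ‖f x‖ ≤ (|N 0| + |N (k + 3)| * M ^ (k + 3)) * ε := fun x => by
    have h1 := hf.bound 0 x
    rw [norm_iteratedFDeriv_zero] at h1
    refine h1.trans (mul_le_mul_of_nonneg_right ?_ hε.le)
    have : 0 ≤ |N (k + 3)| * M ^ (k + 3) := by positivity
    linarith [le_abs_self (N 0)]
  have hbJ : ∀ i x, ‖h i (k + 3) x‖ ≤ (|N 0| + |N (k + 3)| * M ^ (k + 3)) * ε := fun i x => by
    have h1 := (iteratedFDeriv ℝ (k + 3) f x).le_opNorm fun _ => ![e₁, e₂] i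
    rw [Finset.prod_const, Finset.card_univ, Fintype.card_fin] at h1
    calc ‖h i (k + 3) x‖ ≤ (|N (k + 3)| * ε) * M ^ (k + 3) := by
          refine h1.trans ?_
          have := hL.norm_period_le i
          gcongr
          exact (hf.bound _ x).trans (by gcongr; exact le_abs_self _)
      _ ≤ _ := by nlinarith [abs_nonneg (N 0)]
  have H : ∀ i, HasPeriodDerivs e₁ e₂ i (k + 3)
      ((|N 0| + |N (k + 3)| * M ^ (k + 3)) * ε) (h i) := fun i =>
    ⟨fun j => ⟨hper i j, hcont i j, hper i (j + 1), hcont i (j + 1),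
      fun x => hasDerivAt_iteratedFDeriv_line hf.smooth _ j x⟩, hbJ i⟩
  obtain ⟨φ, hφ, hn⟩ := CauchyRiemannTorus.exists_wiener (hL.cellArea_ne_zero hM) k h0 ⟨_, hb0, H⟩
  exact ⟨φ, hφ, (hn _ hb0 H).trans_eq (by rw [dataConst]; ring)⟩

theorem IsSmoothBigO.clm_comp {E : Type*} [NormedAddCommGroup E] [NormedSpace ℝ E]
    {N : ℕ → ℝ} {ε : ℝ} {f : ℂ → E} (hf : IsSmoothBigO N ε e₁ e₂ f) (T : E →L[ℝ] ℂ)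
    (hT : ‖T‖ ≤ 1) : IsSmoothBigO N ε e₁ e₂ fun x => T (f x) where
  smooth := T.contDiff.comp hf.smooth
  periodic := ⟨fun x => congrArg T (hf.periodic.1 x), fun x => congrArg T (hf.periodic.2 x)⟩
  bound j x := by
    refine (T.norm_iteratedFDeriv_comp_left hf.smooth.contDiffAt
      (by exact_mod_cast le_top)).trans ?_
    exact (mul_le_of_le_one_left (norm_nonneg _) hT).trans (hf.bound j x)

/-- The Cauchy bound for the Taylor coefficients of the nonlinearity in the Wiener algebra. -/
def nonlinConst (k : ℕ) (M : ℝ) : ℝ :=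
  wienerConst k * ((k + 3).factorial * (2 * M ^ 2) ^ (k + 3) * M)

theorem nonlinConst_nonneg (k : ℕ) (hM : 1 ≤ M) : 0 ≤ nonlinConst k M :=
  mul_nonneg (wienerConst_nonneg k) (by positivity)

/-- The `x`-derivatives cost a factor independent of the Cauchy radius `r` in `ξ`, so the quadratic
bound in `r` survives in the Wiener norm. -/
theorem IsNonlinearity.exists_wiener {F : (ℂ × ℂ) × (ℂ × ℂ) → ℂ} (hL : IsLatticeBasis M e₁ e₂)
    (hM : 1 ≤ M) (hF : IsNonlinearity M e₁ e₂ F) (k : ℕ) :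
    ∃ c : ℕ × ℕ → Wiener k,
      (∀ i x, Wiener.evalHom e₁ e₂ x (c i) = taylorCoeff F i x) ∧
      QuadraticCoeffs c (nonlinConst k M) (1 / (2 * M)) := by
  have hM0 : 0 < M := by linarith
  have key : ∀ i : ℕ × ℕ, ∃ φ : Wiener k,
      (∀ x, Wiener.evalHom e₁ e₂ x φ = taylorCoeff F i x) ∧
      ∀ r, 0 < r → r ≤ 1 / (2 * M) → ‖φ‖ * r ^ (i.1 + i.2) ≤ nonlinConst k M * r ^ 2 := by
    intro i
    set q : ℂ := (i.1.factorial * i.2.factorial : ℂ) with hq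
    -- The `x`-derivatives are taken on the holomorphic extension, so that Cauchy's estimate
    -- applies, and then restricted to real `x`.
    set h : Fin 2 → ℕ → ℂ → ℂ := fun l j x =>
      (dirDeriv (toC2 (![e₁, e₂] l), 0))^[j] (derivCoeff F i) (toC2 x, 0) / q with hh
    have h0 : ∀ l, h l 0 = taylorCoeff F i := fun l => rfl
    have hder : ∀ l j, HasPeriodDeriv e₁ e₂ l (h l j) (h l (j + 1)) := fun l j => by
      have hper : ∀ j, LatticePeriodic e₁ e₂ (h l j) := fun j => by
        have := hF.latticePeriodic_dirDeriv hM i (toC2 (![e₁, e₂] l), 0) j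
        exact ⟨fun x => congrArg (· / q) (this.1 x), fun x => congrArg (· / q) (this.2 x)⟩
      have hc : ∀ j, Continuous (h l j) := fun j =>
        (hF.continuous_dirDeriv hM i (toC2 (![e₁, e₂] l), 0) j).div_const q
      exact ⟨hper j, hc j, hper (j + 1), hc (j + 1), fun x =>
        (hF.hasDerivAt_dirDeriv hM i (![e₁, e₂] l) j x).div_const q⟩
    have hbound : ∀ r, 0 < r → r ≤ 1 / (2 * M) → ∀ J l x, ‖h l J x‖ ≤
        J.factorial * (2 * M ^ 2) ^ J * M * r ^ 2 / r ^ (i.1 + i.2) := fun r hr hr0 J l x => by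
      have hrM : r < 1 / M := hr0.trans_lt (by
        rw [one_div_lt_one_div (by positivity) (by positivity)]; linarith)
      have h1 := hF.norm_dirDeriv_derivCoeff_le hM i x (hL.norm_period_le l) hr hrM J
      rw [hh]
      simp only
      rw [norm_div, hq, norm_mul, Complex.norm_natCast, Complex.norm_natCast]
      have hf1 : (0 : ℝ) < i.1.factorial := by exact_mod_cast Nat.factorial_pos _
      have hf2 : (0 : ℝ) < i.2.factorial := by exact_mod_cast Nat.factorial_pos _
      rw [div_le_iff₀ (by positivity)]
      refine h1.trans_eq ?_
      rw [one_div, inv_pow, div_inv_eq_mul, pow_add]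
      field_simp
    have hH : ∀ r, 0 < r → r ≤ 1 / (2 * M) →
        (∀ x, ‖taylorCoeff F i x‖ ≤ (k + 3).factorial * (2 * M ^ 2) ^ (k + 3) * M * r ^ 2 /
          r ^ (i.1 + i.2)) ∧ ∀ l, HasPeriodDerivs e₁ e₂ l (k + 3) ((k + 3).factorial *
          (2 * M ^ 2) ^ (k + 3) * M * r ^ 2 / r ^ (i.1 + i.2)) (h l) := fun r hr hr0 => by
      refine ⟨fun x => ?_, fun l => ⟨hder l, hbound r hr hr0 (k + 3) l⟩⟩
      have h1 := hbound r hr hr0 0 0 x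
      rw [h0, Nat.factorial_zero, pow_zero, Nat.cast_one, mul_one, one_mul] at h1
      refine h1.trans ?_
      gcongr
      refine le_mul_of_one_le_left hM0.le ?_
      have h2 : (1 : ℝ) ≤ (k + 3).factorial := by exact_mod_cast Nat.factorial_pos _
      have h3 : (1 : ℝ) ≤ (2 * M ^ 2) ^ (k + 3) := one_le_pow₀ (by nlinarith)
      nlinarith
    have hr0 : 0 < 1 / (2 * M) := by positivity
    obtain ⟨φ, hφ, hn⟩ := CauchyRiemannTorus.exists_wiener (hL.cellArea_ne_zero hM) k h0
      ⟨_, hH _ hr0 le_rfl⟩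
    refine ⟨φ, hφ, fun r hr hr0 => ?_⟩
    have h1 := hn _ (hH r hr hr0).1 (hH r hr hr0).2
    rw [mul_div_assoc', le_div_iff₀ (by positivity)] at h1
    refine h1.trans_eq ?_
    rw [nonlinConst]; ring
  choose c hc hb using key
  exact ⟨c, hc, ⟨hb⟩⟩

/-- Substitution in the Wiener algebra is composition of functions. -/
theorem IsNonlinearity.evalHom_psEval {F : (ℂ × ℂ) × (ℂ × ℂ) → ℂ} (hM : 1 ≤ M)
    (hF : IsNonlinearity M e₁ e₂ F) {k : ℕ} {c : ℕ × ℕ → Wiener k} {B : ℝ}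
    (hc : ∀ i x, Wiener.evalHom e₁ e₂ x (c i) = taylorCoeff F i x)
    (hB : QuadraticCoeffs c B (1 / (2 * M))) {R : ℝ} (hR : 0 < R) (hRM : 4 * R ≤ 1 / (2 * M))
    {P Q : Wiener k} (hP : ‖P‖ ≤ R) (hQ : ‖Q‖ ≤ R) (x : ℂ) :
    Wiener.evalHom e₁ e₂ x (psEval c P Q) =
      F (toC2 x, (Wiener.evalHom e₁ e₂ x P, Wiener.evalHom e₁ e₂ x Q)) := by
  have h1 := hB.hasSum hR hRM hP hQ
  have hcont : Continuous (Wiener.evalHom (k := k) e₁ e₂ x) :=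
    AddMonoidHomClass.continuous_of_bound (Wiener.evalHom e₁ e₂ x) 1 fun f => by
      rw [one_mul]; exact Wiener.norm_evalHom_le e₁ e₂ x f
  have h2 := h1.map (Wiener.evalHom (k := k) e₁ e₂ x) hcont
  rw [← hF.psEval_taylorCoeff hM x hR hRM ((Wiener.norm_evalHom_le e₁ e₂ x P).trans hP)
    ((Wiener.norm_evalHom_le e₁ e₂ x Q).trans hQ), ← h2.tsum_eq, psEval]
  refine tsum_congr fun i => ?_
  simp only [Function.comp_apply, map_mul, map_pow, hc]

/-- The nonlinearity has Lipschitz constant `O(R)` on the ball of radius `R`. -/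
theorem IsNonlinearity.norm_sub_le {F : (ℂ × ℂ) × (ℂ × ℂ) → ℂ} (hM : 1 ≤ M)
    (hF : IsNonlinearity M e₁ e₂ F) {R : ℝ} (hR : 0 < R) (hRM : 4 * R ≤ 1 / (2 * M)) (x : ℂ)
    {ξ η : ℂ × ℂ} (hξ : ‖ξ‖ ≤ R) (hη : ‖η‖ ≤ R) :
    ‖F (toC2 x, ξ) - F (toC2 x, η)‖ ≤ 64 * M * R * ‖ξ - η‖ := by
  have h1 := (norm_fst_le ξ).trans hξ
  have h2 := (norm_snd_le ξ).trans hξ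
  have h3 := (norm_fst_le η).trans hη
  have h4 := (norm_snd_le η).trans hη
  have h := (hF.quadraticCoeffs_taylorCoeff hM x).norm_psEval_sub_le hR hRM h1 h2 h3 h4
    (norm_fst_le (ξ - η)) (norm_snd_le (ξ - η))
  rwa [hF.psEval_taylorCoeff hM x hR hRM h1 h2, hF.psEval_taylorCoeff hM x hR hRM h3 h4] at h

end Data

/-! ### Existence -/

theorem exists_fixedPoint_of_unitBall {X : Type*} [NormedAddCommGroup X] [CompleteSpace X]
    {T : X → X} {δ : ℝ} (hδ : δ ≤ 1) (hT : ∀ f, ‖f‖ ≤ 1 → ‖T f‖ ≤ δ)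
    (hlip : ∀ f g, ‖f‖ ≤ 1 → ‖g‖ ≤ 1 → ‖T f - T g‖ ≤ 1 / 2 * ‖f - g‖) :
    ∃ f, ‖f‖ ≤ δ ∧ T f = f := by
  have hmaps : Set.MapsTo T (Metric.closedBall 0 1) (Metric.closedBall 0 1) := fun f hf => by
    rw [mem_closedBall_zero_iff] at hf ⊢
    exact (hT f hf).trans hδ
  have hcontr : ContractingWith (1 / 2) (hmaps.restrict T _ _) := by
    refine ⟨by rw [← NNReal.coe_lt_coe]; norm_num, LipschitzWith.of_dist_le_mul fun f g => ?_⟩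
    have := hlip f g (mem_closedBall_zero_iff.1 f.2) (mem_closedBall_zero_iff.1 g.2)
    rw [Subtype.dist_eq, Subtype.dist_eq, dist_eq_norm, dist_eq_norm]
    simpa using this
  obtain ⟨f, hf, hfix, -⟩ := ContractingWith.exists_fixedPoint' Metric.isClosed_closedBall.isComplete
    hmaps hcontr (x := 0) (by simp) (edist_ne_top _ _)
  rw [mem_closedBall_zero_iff] at hf
  have h1 : T f = f := hfix
  exact ⟨f, by rw [← h1]; exact hT f hf, h1⟩

/-- The smallness condition on the upper bound `κ` for the two small parameters. -/
structure IsSmallParameter (k : ℕ) (M : ℝ) (N : ℕ → ℝ) (κ : ℝ) : Prop where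
  pos : 0 < κ
  mul_data : dataConst k M N * κ ≤ 1 / 2
  mul_nonlin : 1024 * nonlinConst k M * κ ≤ 1 / 2
  mul_M : 768 * M * κ ≤ 1
  mul_N : |N 0| * κ ≤ 1

section Solution

variable {e₁ e₂ : ℂ} {M : ℝ} {N : ℕ → ℝ} {k : ℕ} {κ ε ε' : ℝ} {a : ℂ}
  {F : (ℂ × ℂ) × (ℂ × ℂ) → ℂ} {γ : ℂ → ℂ × ℂ} {r : ℂ → ℂ}

theorem IsSmallParameter.four_mul_le (hκ : IsSmallParameter k M N κ) (hM : 1 ≤ M)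
    (hε'κ : ε' ≤ κ) : 4 * (4 * ε') ≤ 1 / (2 * M) := by
  rw [le_div_iff₀ (by positivity)]
  have := hκ.mul_M
  have := mul_le_mul_of_nonneg_left hε'κ (by linarith : (0 : ℝ) ≤ M)
  have := mul_nonneg (by linarith : (0 : ℝ) ≤ M) hκ.pos.le
  linarith

/-- Undoing the rescaling leaves `F` at an argument of size `O(ε')` and a single factor `1/ε'`. -/
theorem mul_Ga_eq (hε' : 0 < ε') (x : ℂ) (ξ : ℂ × ℂ) :
    (ε' : ℂ) * Ga F a ε' x (ξ - (ε' : ℂ)⁻¹ • γ x) =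
      (ε' : ℂ)⁻¹ * F (toC2 x, (ε' : ℂ) • ξ - γ x + ((ε' : ℂ) * a) • dx) := by
  have h0 : (ε' : ℂ) ≠ 0 := Complex.ofReal_ne_zero.2 hε'.ne'
  rw [Ga, G, smul_add, smul_sub, smul_smul, smul_smul, mul_inv_cancel₀ h0, one_smul]
  field_simp

theorem exists_solution (hL : IsLatticeBasis M e₁ e₂) (hM : 1 ≤ M)
    (hF : IsNonlinearity M e₁ e₂ F) (hγ : IsSmoothBigO N ε e₁ e₂ γ)
    (hr : IsSmoothBigO N ε e₁ e₂ r) (hκ : IsSmallParameter (k + 1) M N κ) (hε : 0 < ε)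
    (hεκ : ε ≤ κ * ε') (hε'κ : ε' ≤ κ) (ha : ‖a‖ < 1) :
    ∃ f : Wiener (k + 1),
      ‖f‖ ≤ 1024 * nonlinConst (k + 1) M * ε' + dataConst (k + 1) M N * (ε / ε') ∧
      SolvesEquation F γ r ε' a (gradPeriodic (primitive e₁ e₂ f) (Wiener.coeff f 0)) := by
  have hε' : 0 < ε' := by
    by_contra h
    nlinarith [hκ.pos]
  have h0 : (ε' : ℂ) ≠ 0 := Complex.ofReal_ne_zero.2 hε'.ne'
  set S := dataConst (k + 1) M N with hS
  set B := nonlinConst (k + 1) M with hBdef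
  have hS0 : 0 ≤ S := dataConst_nonneg _ hM N
  have hB0 : 0 ≤ B := nonlinConst_nonneg _ hM
  have hSε : S * ε ≤ ε' / 2 := by
    nlinarith [hκ.mul_data, mul_le_mul_of_nonneg_left hεκ hS0]
  have hR := hκ.four_mul_le hM hε'κ
  obtain ⟨c, hc, hB⟩ := hF.exists_wiener hL hM (k + 1)
  obtain ⟨g₁, hg₁, hn₁⟩ := (hγ.clm_comp (ContinuousLinearMap.fst ℝ ℂ ℂ)
    (ContinuousLinearMap.norm_fst_le ..)).exists_wiener hL hM hε (k + 1)
  obtain ⟨g₂, hg₂, hn₂⟩ := (hγ.clm_comp (ContinuousLinearMap.snd ℝ ℂ ℂ)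
    (ContinuousLinearMap.norm_snd_le ..)).exists_wiener hL hM hε (k + 1)
  obtain ⟨ρ, hρ, hnρ⟩ := hr.exists_wiener hL hM hε (k + 1)
  -- `P f` and `Q f` are the two components of `ε'u' - γ + ε'a dx`, with `u'` expressed through `f`
  -- and its Beurling transform. The mean of `f` has cancelled against `b`.
  set P : Wiener (k + 1) → Wiener (k + 1) := fun f =>
    (ε' : ℂ) • (f + beurling e₁ e₂ f) - g₁ + ((ε' : ℂ) * a) • (1 : Wiener (k + 1)) with hP
  set Q : Wiener (k + 1) → Wiener (k + 1) := fun f =>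
    ((ε' : ℂ) * Complex.I) • (beurling e₁ e₂ f - f) - g₂ +
      ((ε' : ℂ) * a * Complex.I) • (1 : Wiener (k + 1)) with hQ
  have hnε : ‖(ε' : ℂ)‖ = ε' := by rw [Complex.norm_real, Real.norm_of_nonneg hε'.le]
  have hnB : ∀ f : Wiener (k + 1), ‖f‖ ≤ 1 → ‖beurling e₁ e₂ f‖ ≤ 1 := fun f hf =>
    (norm_beurling_le f).trans hf
  -- The three terms contribute `2ε'`, `ε'/2` and `ε'`; the radius `4ε'` is a rounding up.
  have hPn : ∀ f, ‖f‖ ≤ 1 → ‖P f‖ ≤ 4 * ε' := fun f hf => by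
    have h1 : ‖(ε' : ℂ) • (f + beurling e₁ e₂ f)‖ ≤ ε' * 2 := by
      rw [norm_smul, hnε]
      gcongr
      exact (norm_add_le _ _).trans (by linarith [hnB f hf])
    have h2 : ‖((ε' : ℂ) * a) • (1 : Wiener (k + 1))‖ ≤ ε' := by
      rw [norm_smul, norm_one, mul_one, norm_mul, hnε]
      exact mul_le_of_le_one_right hε'.le ha.le
    exact (norm_add_le _ _).trans (by linarith [norm_sub_le ((ε' : ℂ) • (f + beurling e₁ e₂ f)) g₁])
  have hQn : ∀ f, ‖f‖ ≤ 1 → ‖Q f‖ ≤ 4 * ε' := fun f hf => by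
    have h1 : ‖((ε' : ℂ) * Complex.I) • (beurling e₁ e₂ f - f)‖ ≤ ε' * 2 := by
      rw [norm_smul, norm_mul, Complex.norm_I, mul_one, hnε]
      gcongr
      exact (norm_sub_le _ _).trans (by linarith [hnB f hf])
    have h2 : ‖((ε' : ℂ) * a * Complex.I) • (1 : Wiener (k + 1))‖ ≤ ε' := by
      rw [norm_smul, norm_one, mul_one, norm_mul, norm_mul, Complex.norm_I, mul_one, hnε]
      exact mul_le_of_le_one_right hε'.le ha.le
    exact (norm_add_le _ _).trans
      (by linarith [norm_sub_le (((ε' : ℂ) * Complex.I) • (beurling e₁ e₂ f - f)) g₂])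
  have hbs : ∀ f g : Wiener (k + 1), ‖beurling e₁ e₂ f - beurling e₁ e₂ g‖ ≤ ‖f - g‖ :=
    fun f g => by rw [← beurling_sub]; exact norm_beurling_le _
  have hPl : ∀ f g, ‖P f - P g‖ ≤ 2 * ε' * ‖f - g‖ := fun f g => by
    have h1 : P f - P g =
        (ε' : ℂ) • ((f - g) + (beurling e₁ e₂ f - beurling e₁ e₂ g)) := by
      simp only [hP, smul_add, smul_sub]; abel
    rw [h1, norm_smul, hnε]
    nlinarith [norm_add_le (f - g) (beurling e₁ e₂ f - beurling e₁ e₂ g), hbs f g]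
  have hQl : ∀ f g, ‖Q f - Q g‖ ≤ 2 * ε' * ‖f - g‖ := fun f g => by
    have h1 : Q f - Q g =
        ((ε' : ℂ) * Complex.I) • ((beurling e₁ e₂ f - beurling e₁ e₂ g) - (f - g)) := by
      simp only [hQ, smul_sub]; abel
    rw [h1, norm_smul, norm_mul, Complex.norm_I, mul_one, hnε]
    nlinarith [norm_sub_le (beurling e₁ e₂ f - beurling e₁ e₂ g) (f - g), hbs f g]
  have hinv : ‖(ε' : ℂ)⁻¹‖ = ε'⁻¹ := by rw [norm_inv, hnε]
  have hεpos : 0 < 4 * ε' := by positivity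
  have hδ : 1024 * B * ε' + S * (ε / ε') ≤ 1 := by
    have h1 : S * (ε / ε') ≤ 1 / 2 := by
      rw [← mul_div_assoc, div_le_iff₀ hε']; linarith
    have h2 := mul_le_mul_of_nonneg_left hε'κ (by positivity : 0 ≤ 1024 * B)
    linarith [hκ.mul_nonlin]
  -- On this radius the quadratic bound is `64 B (4ε')² = 1024 B ε'²`, and one factor `ε'` is lost
  -- to the division. In the Lipschitz bound `512 = 64 · 4 · 2`.
  obtain ⟨f, hfn, hfix⟩ := exists_fixedPoint_of_unitBall
    (T := fun f => (ε' : ℂ)⁻¹ • (ρ - psEval c (P f) (Q f)))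
    (δ := 1024 * B * ε' + S * (ε / ε')) hδ
    (fun f hf => by
      have h1 := hB.norm_psEval_le hεpos hR (hPn f hf) (hQn f hf)
      rw [norm_smul, hinv, inv_mul_le_iff₀ hε']
      refine (norm_sub_le _ _).trans ((add_le_add hnρ h1).trans_eq ?_)
      field_simp
      ring)
    (fun f g hf hg => by
      have h1 := hB.norm_psEval_sub_le hεpos hR (hPn g hg) (hQn g hg) (hPn f hf) (hQn f hf)
        (hPl g f) (hQl g f)
      rw [← smul_sub, norm_smul, hinv, inv_mul_le_iff₀ hε', sub_sub_sub_cancel_left]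
      refine h1.trans ?_
      rw [norm_sub_rev g f]
      have h2 := mul_le_mul_of_nonneg_left hε'κ (by positivity : 0 ≤ 1024 * B)
      have h3 : 512 * B * ε' ≤ 1 / 2 := by linarith [hκ.mul_nonlin]
      calc 64 * B * (4 * ε') * (2 * ε' * ‖f - g‖)
          = (512 * B * ε') * (ε' * ‖f - g‖) := by ring
        _ ≤ 1 / 2 * (ε' * ‖f - g‖) := by gcongr
        _ = _ := by ring)
  have hf1 : ‖f‖ ≤ 1 := hfn.trans hδ
  refine ⟨f, hfn, fun x => ?_⟩
  have hdiff : Differentiable ℝ (primitive e₁ e₂ f) :=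
    (contDiff_primitive hL hM f).differentiable (by simp)
  have hgrad := grad_gradPeriodic hdiff (Wiener.coeff f 0) x
  rw [grad_primitive hL hM] at hgrad
  set E := Wiener.evalHom (k := k + 1) e₁ e₂ x with hE
  have hval := congrArg E hfix
  simp only [map_smul, map_sub, smul_eq_mul] at hval
  rw [hF.evalHom_psEval hM hc hB hεpos hR (hPn f hf1) (hQn f hf1), hρ] at hval
  have hξ : (ε' : ℂ) • grad (gradPeriodic (primitive e₁ e₂ f) (Wiener.coeff f 0)) x - γ x +
      ((ε' : ℂ) * a) • dx = (E (P f), E (Q f)) := by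
    have hg₁' : E g₁ = (γ x).1 := hg₁ x
    have hg₂' : E g₂ = (γ x).2 := hg₂ x
    rw [hgrad]
    refine Prod.ext ?_ ?_
    · simp only [hP, map_add, map_sub, map_smul, map_one, hg₁', dx, Prod.fst_add, Prod.fst_sub,
        Prod.smul_fst, smul_eq_mul]
      ring
    · simp only [hQ, map_add, map_sub, map_smul, map_one, hg₂', dx, Prod.snd_add, Prod.snd_sub,
        Prod.smul_snd, smul_eq_mul]
      ring
  have hdbar : dbar (gradPeriodic (primitive e₁ e₂ f) (Wiener.coeff f 0)) x = E f := by
    rw [dbar, hgrad]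
    linear_combination (1 / 2 * (E (beurling e₁ e₂ f) - E f)) * Complex.I_mul_I
  rw [mul_Ga_eq hε', hξ, hdbar, ← hval]
  field_simp
  ring

/-! ### Uniqueness -/

theorem LatticePeriodic.fderiv_apply {w : ℂ → ℂ} (hw : LatticePeriodic e₁ e₂ w) (v : ℂ) :
    LatticePeriodic e₁ e₂ fun x => fderiv ℝ w x v := by
  have key : ∀ e, Function.Periodic w e → Function.Periodic (fun x => fderiv ℝ w x v) e :=
    fun e he x => by
      have h1 : (fun z => w (z + e)) = w := funext he
      simp only
      rw [← fderiv_comp_add_right, h1]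
  exact ⟨key _ hw.1, key _ hw.2⟩

/-- Only derivatives along the periods integrate by parts directly; a general direction `v` is
decomposed along `e₁, e₂`. -/
theorem fourierC_fderiv (hA : cellArea e₁ e₂ ≠ 0) {w : ℂ → ℂ} (hw : LatticePeriodic e₁ e₂ w)
    (hw1 : ContDiff ℝ 1 w) (v : ℂ) (n : Fin 2 → ℤ) :
    fourierC e₁ e₂ (fun x => fderiv ℝ w x v) n = charForm e₁ e₂ n v * fourierC e₁ e₂ w n := by
  have hper : ∀ v, LatticePeriodic e₁ e₂ fun x => fderiv ℝ w x v := hw.fderiv_apply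
  have hcont : ∀ v, Continuous fun x => fderiv ℝ w x v := fun v =>
    (hw1.continuous_fderiv one_ne_zero).clm_apply continuous_const
  have hd : ∀ i, HasPeriodDeriv e₁ e₂ i w fun x => fderiv ℝ w x (![e₁, e₂] i) := fun i => by
    refine ⟨hw, hw1.continuous, hper _, hcont _, fun x => ?_⟩
    have hline : HasDerivAt (fun s : ℝ => x + s * ![e₁, e₂] i) (![e₁, e₂] i) 0 := by
      have := ((hasDerivAt_id (0 : ℝ)).ofReal_comp.mul_const (![e₁, e₂] i)).const_add x
      simpa using this
    have h1 := (hw1.differentiable one_ne_zero (x + (0 : ℝ) * ![e₁, e₂] i)).hasFDerivAt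
    have h2 := h1.comp_hasDerivAt (0 : ℝ) hline
    simp only [Complex.ofReal_zero, zero_mul, add_zero] at h2
    exact h2
  have hv : (fun x => fderiv ℝ w x v) = fun x =>
      (coord e₁ e₂ 0 v : ℂ) * fderiv ℝ w x e₁ + (coord e₁ e₂ 1 v : ℂ) * fderiv ℝ w x e₂ :=
    funext fun x => by
      conv_lhs => rw [eq_combination hA v]
      rw [← Complex.real_smul, ← Complex.real_smul, map_add, map_smul, map_smul,
        Complex.real_smul, Complex.real_smul]
  have h0 : fourierC e₁ e₂ (fun x => fderiv ℝ w x e₁) n = _ := (hd 0).fourierC_eq hA n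
  have h1 : fourierC e₁ e₂ (fun x => fderiv ℝ w x e₂) n = _ := (hd 1).fourierC_eq hA n
  rw [hv, fourierC_linear hA (hper e₁) (hcont e₁) (hper e₂) (hcont e₂), h0, h1, charForm_apply,
    dualForm]
  simp only [add_apply, smul_apply, smul_eq_mul]
  push_cast
  ring

/-- If `|∂̄w| ≤ |∂w| / 2` for a grad-periodic function `w = u + b x̄`, then `w` is constant. -/
theorem grad_eq_zero_of_norm_dbar_le (hL : IsLatticeBasis M e₁ e₂) (hM : 1 ≤ M) {w : ℂ → ℂ}
    (hw : LatticePeriodic e₁ e₂ w) (hw1 : ContDiff ℝ 1 w) (b : ℂ)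
    (hle : ∀ x, ‖1 / 2 * (fderiv ℝ w x 1 + Complex.I * fderiv ℝ w x Complex.I) + b‖ ≤
      1 / 2 * ‖1 / 2 * (fderiv ℝ w x 1 - Complex.I * fderiv ℝ w x Complex.I)‖) (x : ℂ) :
    fderiv ℝ w x 1 = -b ∧ fderiv ℝ w x Complex.I = b * Complex.I := by
  have hA := hL.cellArea_ne_zero hM
  have hper : ∀ v, LatticePeriodic e₁ e₂ fun x => fderiv ℝ w x v := hw.fderiv_apply
  have hcont : ∀ v, Continuous fun x => fderiv ℝ w x v := fun v =>
    (hw1.continuous_fderiv one_ne_zero).clm_apply continuous_const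
  set D : ℂ → ℂ := fun x =>
    1 / 2 * fderiv ℝ w x 1 + -(1 / 2 * Complex.I) * fderiv ℝ w x Complex.I with hD
  set Db : ℂ → ℂ := fun x =>
    1 / 2 * fderiv ℝ w x 1 + (1 / 2 * Complex.I) * fderiv ℝ w x Complex.I with hDb
  have hlin : ∀ p q : ℂ, LatticePeriodic e₁ e₂ (fun x => p * fderiv ℝ w x 1 +
      q * fderiv ℝ w x Complex.I) ∧ Continuous (fun x => p * fderiv ℝ w x 1 +
      q * fderiv ℝ w x Complex.I) := fun p q =>
    ⟨⟨fun x => congrArg₂ (fun s t => p * s + q * t) ((hper 1).1 x) ((hper Complex.I).1 x),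
      fun x => congrArg₂ (fun s t => p * s + q * t) ((hper 1).2 x) ((hper Complex.I).2 x)⟩,
      ((hcont 1).const_mul p).add ((hcont Complex.I).const_mul q)⟩
  have hcoef : ∀ (p q : ℂ) n, fourierC e₁ e₂ (fun x => p * fderiv ℝ w x 1 +
      q * fderiv ℝ w x Complex.I) n =
      (p * charForm e₁ e₂ n 1 + q * charForm e₁ e₂ n Complex.I) * fourierC e₁ e₂ w n :=
    fun p q n => by
      rw [fourierC_linear hA (hper 1) (hcont 1) (hper Complex.I) (hcont Complex.I),
        fourierC_fderiv hA hw hw1, fourierC_fderiv hA hw hw1]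
      ring
  have hDc : ∀ n, fourierC e₁ e₂ D n = delSymbol e₁ e₂ n * fourierC e₁ e₂ w n := fun n => by
    rw [hD, hcoef, delSymbol]; ring
  have hDbc : ∀ n, fourierC e₁ e₂ Db n = dbarSymbol e₁ e₂ n * fourierC e₁ e₂ w n := fun n => by
    rw [hDb, hcoef, dbarSymbol]; ring
  have hsum : (fun x => Db x + b) = fun x => 1 * Db x + 1 * b := by simp
  have hconst : LatticePeriodic e₁ e₂ fun _ => b := ⟨fun _ => rfl, fun _ => rfl⟩
  -- For `n ≠ 0` the constant `b` does not contribute and the symbols have equal modulus; for `n =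
  -- 0` the left side is zero.
  have hfour : ∀ n, ‖fourierC e₁ e₂ D n‖ ≤ ‖fourierC e₁ e₂ (fun x => Db x + b) n‖ := fun n => by
    rcases eq_or_ne n 0 with rfl | hn
    · rw [hDc, norm_mul, norm_delSymbol, dbarSymbol_zero, norm_zero, zero_mul]
      exact norm_nonneg _
    · rw [hsum, fourierC_linear hA (hlin _ _).1 (hlin _ _).2 hconst continuous_const,
        fourierC_const hA b hn, hDc, hDbc, mul_zero, add_zero, one_mul, norm_mul, norm_mul,
        norm_delSymbol]
  have hD' : ∀ x, D x = 1 / 2 * (fderiv ℝ w x 1 - Complex.I * fderiv ℝ w x Complex.I) :=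
    fun x => by rw [hD]; ring
  have hDb' : ∀ x, Db x = 1 / 2 * (fderiv ℝ w x 1 + Complex.I * fderiv ℝ w x Complex.I) :=
    fun x => by rw [hDb]; ring
  have hle' : ∀ x, ‖Db x + b‖ ≤ 1 / 2 * ‖D x‖ := fun x => by
    rw [hD', hDb']; exact hle x
  have hzero := eq_zero_of_fourierC_le hA (hlin _ _).1 (hlin _ _).2
    (g := fun x => Db x + b)
    ⟨fun x => congrArg (· + b) ((hlin _ _).1.1 x), fun x => congrArg (· + b) ((hlin _ _).1.2 x)⟩
    ((hlin _ _).2.add continuous_const) hfour hle' x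
  have h1 : D x = 0 := hzero
  have h2 : Db x + b = 0 := by
    have := hle' x
    rw [h1, norm_zero, mul_zero] at this
    exact norm_le_zero_iff.1 this
  rw [hD'] at h1
  rw [hDb'] at h2
  constructor
  · linear_combination h1 + h2
  · linear_combination (Complex.I) * h1 - Complex.I * h2 +
      fderiv ℝ w x Complex.I * Complex.I_mul_I

theorem IsSolutionInBall.norm_le {m R : ℝ} {u : ℂ → ℂ} {b : ℂ}
    (hu : IsSolutionInBall m e₁ e₂ F γ r ε' a R u b) (hR : R ≤ 1) (x : ℂ) :
    ‖b‖ ≤ 1 ∧ ‖grad u x‖ ≤ 1 := by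
  have h1 : size m u b ≤ 1 :=
    hu.size_le.trans (by rw [← ENNReal.ofReal_one]; exact ENNReal.ofReal_le_ofReal hR)
  have hb : ‖b‖ₑ ≤ 1 := le_self_add.trans h1
  have h2 : holderNorm m (grad u) ≤ 1 := le_add_self.trans h1
  have h3 : ‖grad u x‖ₑ ≤ 1 := by
    refine le_trans ?_ (le_self_add.trans h2)
    refine le_trans ?_ (Finset.single_le_sum (f := fun j => ⨆ x : ℂ,
      ‖iteratedFDeriv ℝ j (grad u) x‖ₑ) (fun _ _ => zero_le) (Finset.mem_range.2 (Nat.succ_pos _)))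
    refine le_trans (le_of_eq ?_) (le_iSup _ x)
    rw [← ofReal_norm, ← ofReal_norm, norm_iteratedFDeriv_zero]
  constructor
  · rwa [← ofReal_norm, ← ENNReal.ofReal_one, ENNReal.ofReal_le_ofReal_iff zero_le_one] at hb
  · rwa [← ofReal_norm, ← ENNReal.ofReal_one, ENNReal.ofReal_le_ofReal_iff zero_le_one] at h3

theorem norm_dx : ‖dx‖ = 1 := by simp [dx, Prod.norm_def]

/-- The bound `R ≤ 1` places both arguments of `F` in the ball of radius `4ε'`, where `F` has
Lipschitz constant `O(ε')`. Subtracting the equations then bounds the `x̄`-derivative of the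
difference by a small multiple of its full gradient. -/
theorem IsSolutionInBall.eq_add_const {m R : ℝ} {u v : ℂ → ℂ} {b d : ℂ}
    (hu : IsSolutionInBall m e₁ e₂ F γ r ε' a R u b)
    (hv : IsSolutionInBall m e₁ e₂ F γ r ε' a R v d) (hR : R ≤ 1)
    (hL : IsLatticeBasis M e₁ e₂) (hM : 1 ≤ M) (hF : IsNonlinearity M e₁ e₂ F)
    (hγ : IsSmoothBigO N ε e₁ e₂ γ) (hκ : IsSmallParameter k M N κ) (hε : 0 < ε)
    (hεκ : ε ≤ κ * ε') (hε'κ : ε' ≤ κ) (ha : ‖a‖ < 1) :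
    ∃ c : ℂ, ∀ x : ℂ, gradPeriodic v d x = gradPeriodic u b x + c := by
  have hε' : 0 < ε' := by
    by_contra h
    nlinarith [hκ.pos]
  have hnε : ‖(ε' : ℂ)‖ = ε' := by rw [Complex.norm_real, Real.norm_of_nonneg hε'.le]
  have hu1 : ContDiff ℝ 1 u := hu.contDiff.of_le (by exact_mod_cast Nat.le_add_left 1 _)
  have hv1 : ContDiff ℝ 1 v := hv.contDiff.of_le (by exact_mod_cast Nat.le_add_left 1 _)
  have hud := hu1.differentiable one_ne_zero
  have hvd := hv1.differentiable one_ne_zero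
  have hw1 : ContDiff ℝ 1 fun x => v x - u x := hv1.sub hu1
  have hwp : LatticePeriodic e₁ e₂ fun x => v x - u x :=
    ⟨hv.periodic.1.sub hu.periodic.1, hv.periodic.2.sub hu.periodic.2⟩
  have hfw : ∀ x, fderiv ℝ (fun x => v x - u x) x = fderiv ℝ v x - fderiv ℝ u x := fun x =>
    fderiv_fun_sub (hvd x) (hud x)
  have hγ0 : ∀ x, ‖γ x‖ ≤ ε' := fun x => by
    have h1 := hγ.bound 0 x
    rw [norm_iteratedFDeriv_zero] at h1
    calc ‖γ x‖ ≤ |N 0| * (κ * ε') :=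
          h1.trans (mul_le_mul (le_abs_self _) hεκ hε.le (abs_nonneg _))
      _ = (|N 0| * κ) * ε' := by ring
      _ ≤ 1 * ε' := by gcongr; exact hκ.mul_N
      _ = ε' := one_mul _
  have hball : ∀ {u : ℂ → ℂ} {b : ℂ}, IsSolutionInBall m e₁ e₂ F γ r ε' a R u b →
      Differentiable ℝ u → ∀ x,
      ‖(ε' : ℂ) • grad (gradPeriodic u b) x - γ x + ((ε' : ℂ) * a) • dx‖ ≤ 4 * ε' := by
    intro u b hu hud x
    obtain ⟨hb, hg⟩ := hu.norm_le hR x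
    have h1 : ‖grad (gradPeriodic u b) x‖ ≤ 2 := by
      rw [grad_gradPeriodic hud]
      refine max_le ((norm_add_le _ _).trans ?_) ((norm_sub_le _ _).trans ?_)
      · linarith [(norm_fst_le (grad u x)).trans hg]
      · rw [norm_mul, Complex.norm_I, mul_one]
        linarith [(norm_snd_le (grad u x)).trans hg]
    have h2 : ‖(ε' : ℂ) • grad (gradPeriodic u b) x‖ ≤ ε' * 2 := by
      rw [norm_smul, hnε]; gcongr
    have h3 : ‖((ε' : ℂ) * a) • dx‖ ≤ ε' := by
      rw [norm_smul, norm_dx, mul_one, norm_mul, hnε]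
      exact mul_le_of_le_one_right hε'.le ha.le
    refine (norm_add_le _ _).trans ?_
    linarith [norm_sub_le ((ε' : ℂ) • grad (gradPeriodic u b) x) (γ x), hγ0 x]
  have hzero := grad_eq_zero_of_norm_dbar_le hL hM hwp hw1 (d - b) fun x => by
    set U := grad (gradPeriodic u b) x with hU
    set V := grad (gradPeriodic v d) x with hV
    have hU' := grad_gradPeriodic hud b x
    have hV' := grad_gradPeriodic hvd d x
    rw [← hU] at hU'
    rw [← hV] at hV'
    -- `α` and `β` are the `x̄`- and `x`-derivatives of the difference of the two solutions; the
    -- part linear in `x̄` enters only `α`.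
    set α : ℂ := 1 / 2 * (fderiv ℝ (fun x => v x - u x) x 1 +
      Complex.I * fderiv ℝ (fun x => v x - u x) x Complex.I) + (d - b) with hα
    set β : ℂ := 1 / 2 * (fderiv ℝ (fun x => v x - u x) x 1 -
      Complex.I * fderiv ℝ (fun x => v x - u x) x Complex.I) with hβ
    rw [hfw, sub_apply, sub_apply] at hα hβ
    have h1 : V.1 - U.1 = α + β := by
      rw [hU', hV', hα, hβ]; simp only [grad]; ring
    have h2 : V.2 - U.2 = Complex.I * (β - α) := by
      rw [hU', hV', hα, hβ]; simp only [grad]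
      linear_combination (fderiv ℝ v x Complex.I - fderiv ℝ u x Complex.I) * Complex.I_mul_I
    have hα' : dbar (gradPeriodic v d) x - dbar (gradPeriodic u b) x = α := by
      rw [dbar, dbar, ← hU, ← hV]
      linear_combination 1 / 2 * h1 + Complex.I / 2 * h2 + (1 / 2 * (β - α)) * Complex.I_mul_I
    have hVU : ‖V - U‖ ≤ ‖α‖ + ‖β‖ := by
      refine max_le ?_ ?_
      · rw [Prod.fst_sub, h1]; exact norm_add_le _ _
      · rw [Prod.snd_sub, h2, norm_mul, Complex.norm_I, one_mul, add_comm]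
        exact norm_sub_le _ _
    have heq : α = (ε' : ℂ)⁻¹ * (F (toC2 x, (ε' : ℂ) • U - γ x + ((ε' : ℂ) * a) • dx) -
        F (toC2 x, (ε' : ℂ) • V - γ x + ((ε' : ℂ) * a) • dx)) := by
      have hsu := hu.solves x
      have hsv := hv.solves x
      rw [mul_Ga_eq hε'] at hsu hsv
      rw [← hα']
      linear_combination hsv - hsu
    have hlip := hF.norm_sub_le hM (by positivity : 0 < 4 * ε') (hκ.four_mul_le hM hε'κ) x
      (hball hu hud x) (hball hv hvd x)
    have hdiff : (ε' : ℂ) • U - γ x + ((ε' : ℂ) * a) • dx -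
        ((ε' : ℂ) • V - γ x + ((ε' : ℂ) * a) • dx) = (ε' : ℂ) • (U - V) := by
      rw [smul_sub]; abel
    rw [← hU, ← hV, hdiff, norm_smul, hnε, norm_sub_rev U V] at hlip
    have hαle : ‖α‖ ≤ 256 * M * ε' * ‖V - U‖ := by
      rw [heq, norm_mul, norm_inv, hnε, inv_mul_le_iff₀ hε']
      exact hlip.trans_eq (by ring)
    -- From `|α| ≤ (|α| + |β|) / 3` follows `|α| ≤ |β| / 2`; this is why `IsSmallParameter` has `768
    -- = 3 · 256`.
    have hsmall : 256 * M * ε' ≤ 1 / 3 := by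
      have := mul_le_mul_of_nonneg_left hε'κ (by linarith : (0 : ℝ) ≤ M)
      linarith [hκ.mul_M]
    have h3 := mul_le_mul hsmall hVU (norm_nonneg _) (by norm_num)
    linarith
  have hconst : ∀ x y, gradPeriodic v d x - gradPeriodic u b x =
      gradPeriodic v d y - gradPeriodic u b y := by
    have hder : ∀ x, HasFDerivAt (fun x => gradPeriodic v d x - gradPeriodic u b x)
        (0 : ℂ →L[ℝ] ℂ) x := fun x => by
      have h1 := (hasFDerivAt_gradPeriodic hvd d x).sub (hasFDerivAt_gradPeriodic hud b x)
      refine h1.congr_fderiv ?_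
      obtain ⟨h2, h3⟩ := hzero x
      rw [hfw, sub_apply] at h2 h3
      refine ContinuousLinearMap.ext fun z => ?_
      have hz : z = z.re • (1 : ℂ) + z.im • Complex.I := by simp
      rw [hz, map_add, map_smul, map_smul]
      have h4 : (fderiv ℝ v x + d • (Complex.conjCLE : ℂ →L[ℝ] ℂ) -
          (fderiv ℝ u x + b • (Complex.conjCLE : ℂ →L[ℝ] ℂ))) 1 = 0 := by
        simp
        linear_combination h2
      have h5 : (fderiv ℝ v x + d • (Complex.conjCLE : ℂ →L[ℝ] ℂ) -
          (fderiv ℝ u x + b • (Complex.conjCLE : ℂ →L[ℝ] ℂ))) Complex.I = 0 := by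
        simp
        linear_combination h3
      rw [h4, h5]
      simp
    exact fun x y => is_const_of_fderiv_eq_zero (𝕜 := ℝ) (fun x => (hder x).differentiableAt)
      (fun x => (hder x).fderiv) x y
  exact ⟨gradPeriodic v d 0 - gradPeriodic u b 0, fun x => by rw [← hconst x 0]; ring⟩

end Solution

/-! ### Choice of the constants and conclusion. -/

theorem exists_isSmallParameter (k : ℕ) {M : ℝ} (hM : 1 ≤ M) (N : ℕ → ℝ) {κ₁ : ℝ} (h₁ : 0 < κ₁) :
    ∃ κ, κ ≤ κ₁ ∧ IsSmallParameter k M N κ := by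
  have hS := dataConst_nonneg k hM N
  have hB := nonlinConst_nonneg k hM
  -- Each smallness condition bounds by 1 the product of `κ` with one nonnegative summand of `T`, so
  -- `κ ≤ 1/T` meets them all.
  set T := 2 * dataConst k M N + 2048 * nonlinConst k M + 768 * M + |N 0| with hT
  have hN := abs_nonneg (N 0)
  have hT0 : 0 < T := by positivity
  have hκ : 0 < min κ₁ T⁻¹ := lt_min h₁ (inv_pos.2 hT0)
  have hle : T * min κ₁ T⁻¹ ≤ 1 := by
    rw [← mul_inv_cancel₀ hT0.ne']
    gcongr
    exact min_le_right _ _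
  have key : ∀ t, t ≤ T → t * min κ₁ T⁻¹ ≤ 1 := fun t ht =>
    (mul_le_mul_of_nonneg_right ht hκ.le).trans hle
  refine ⟨_, min_le_left _ _, hκ, ?_, ?_, key _ ?_, key _ ?_⟩
  · linarith [key (2 * dataConst k M N) (by linarith)]
  · linarith [key (2048 * nonlinConst k M) (by linarith)]
  · linarith
  · linarith

end CauchyRiemannTorus

end

open CauchyRiemannTorus

theorem proposition1p2 (m : ℝ) (hm : 0 < m) (hm_int : ∀ n : ℕ, m ≠ n)
    (M : ℝ) (hM : 1 ≤ M) (N : ℕ → ℝ) :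
    ∃ C₀ : ℝ, 1 ≤ C₀ ∧ ∃ K : ℝ, 0 < K ∧ ∀ C : ℝ, C₀ ≤ C → ∃ κ : ℝ, 0 < κ ∧
      ∀ (e₁ e₂ : ℂ) (F : (ℂ × ℂ) × (ℂ × ℂ) → ℂ) (γ : ℂ → ℂ × ℂ) (r : ℂ → ℂ)
        (ε ε' : ℝ) (a : ℂ),
        0 < ε → ε ≤ κ * ε' → ε' ≤ κ → ‖a‖ < 1 →
        CauchyRiemannTorus.IsLatticeBasis M e₁ e₂ →
        CauchyRiemannTorus.IsNonlinearity M e₁ e₂ F →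
        CauchyRiemannTorus.IsSmoothBigO N ε e₁ e₂ γ →
        CauchyRiemannTorus.IsSmoothBigO N ε e₁ e₂ r →
        ∃ (uper : ℂ → ℂ) (b : ℂ),
          CauchyRiemannTorus.IsSolutionInBall m e₁ e₂ F γ r ε' a (1 / C) uper b ∧
          (∀ (vper : ℂ → ℂ) (d : ℂ),
            CauchyRiemannTorus.IsSolutionInBall m e₁ e₂ F γ r ε' a (1 / C) vper d →
            ∃ c : ℂ, ∀ x : ℂ, CauchyRiemannTorus.gradPeriodic vper d x
              = CauchyRiemannTorus.gradPeriodic uper b x + c) ∧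
          CauchyRiemannTorus.size m uper b ≤ ENNReal.ofReal (K * (ε' + ε / ε')) := by
  set k := ⌊m⌋₊ with hk
  set S := dataConst (k + 1) M N with hS
  set B := nonlinConst (k + 1) M with hB
  have hS0 : 0 ≤ S := dataConst_nonneg _ hM N
  have hB0 : 0 ≤ B := nonlinConst_nonneg _ hM
  have hΛ := one_le_freqBound hM
  have hs0 : 0 < sizeConst m M := by unfold sizeConst; positivity
  -- The summand 1 keeps `K` positive even if `B` and `S` vanish.
  set K := sizeConst m M * (1024 * B + S + 1) with hK
  have hK0 : 0 < K := by positivity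
  -- `C₀ = 1` suffices because uniqueness needs only `1/C ≤ 1`.
  refine ⟨1, le_rfl, K, hK0, fun C hC => ?_⟩
  have hC0 : 0 < C := by linarith
  -- Both `ε'` and `ε/ε'` are at most `κ`, so with `κ ≤ 1/(2KC)` each contributes at most half of
  -- `1/C` and the solution found lies in the required ball.
  obtain ⟨κ, hκC, hκ⟩ := exists_isSmallParameter (k + 1) hM N
    (by positivity : 0 < 1 / (2 * K * C))
  refine ⟨κ, hκ.pos, fun e₁ e₂ F γ r ε ε' a hε hεκ hε'κ ha hL hF hγ hr => ?_⟩
  have hε' : 0 < ε' := by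
    by_contra h
    nlinarith [hκ.pos]
  obtain ⟨f, hf, hsol⟩ := exists_solution (k := k) hL hM hF hγ hr hκ hε hεκ hε'κ ha
  have hbound : size m (primitive e₁ e₂ f) (Wiener.coeff f 0) ≤
      ENNReal.ofReal (K * (ε' + ε / ε')) := by
    refine (size_primitive_le hL hM hm f).trans (ENNReal.ofReal_le_ofReal ?_)
    rw [hK, mul_assoc]
    gcongr
    refine hf.trans ?_
    have : 0 ≤ ε / ε' := by positivity
    nlinarith [mul_nonneg hB0 this, mul_nonneg hS0 hε'.le]
  have hsmall : K * (ε' + ε / ε') ≤ 1 / C := by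
    have h1 : ε / ε' ≤ κ := by rwa [div_le_iff₀ hε']
    calc K * (ε' + ε / ε') ≤ K * (1 / (2 * K * C) + 1 / (2 * K * C)) := by
          exact mul_le_mul_of_nonneg_left
            (add_le_add (hε'κ.trans hκC) (h1.trans hκC)) hK0.le
      _ = 1 / C := by field_simp; norm_num
  have hball : IsSolutionInBall m e₁ e₂ F γ r ε' a (1 / C) (primitive e₁ e₂ f)
      (Wiener.coeff f 0) :=
    ⟨contDiff_primitive hL hM f, primitive_periodic (hL.cellArea_ne_zero hM) f, hsol,
      hbound.trans (ENNReal.ofReal_le_ofReal hsmall)⟩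
  exact ⟨_, _, hball, fun v d hv => hball.eq_add_const hv (div_le_one_of_le₀ hC hC0.le) hL hM hF hγ
    hκ hε hεκ hε'κ ha, hbound⟩
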